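/- Let $K$ be a (commutative) discretely valued field, not necessarily complete, with valuation ring $\mathcal{O}_K$; equivalently, $\mathcal{O}_K$ is a discrete valuation ring with field of fractions $K$. A lattice in a finite-dimensional $K$-vector space $V$ is a free $\mathcal{O}_K$-submodule of rank $\dim_K V$. Two lattices $L, L'$ in $K^d$ are homothetic if $L' = cL$ for some $c \in K\setminus\{0\}$, and $[L]$ denotes the homothety class of $L$. Write $\mathrm{End}_{\mathcal{O}_K}(L) = \{X \in K^{d\times d} : XL \subseteq L\}$, which depends only on $[L]$, and for a non-empty set $\mathcal{L}$ of classes of lattices in $K^d$ put $\mathrm{PZ}(\mathcal{L}) = \bigcap_{[L]\in\mathcal{L}} \mathrm{End}_{\mathcal{O}_K}(L)$. An order in $K^{d\times d}$ is a lattice in $K^{d\times d}$ that is also a subring containing the identity matrix; it is maximal if it is maximal under inclusion among all orders. For an order $\Lambda$ let $Q(\Lambda)$ be the set of classes $[L]$ of lattices $L$ in $K^d$ with $\Lambda L = L$. The order $\Lambda$ is closed if $\Lambda = \mathrm{PZ}(Q(\Lambda))$, and it is graduated if it contains a complete set $\epsilon_1, \ldots, \epsilon_d$ of orthogonal primitive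 idempotents of $K^{d\times d}$. The degree of a closed order $\Lambda$ is the minimum of $|\mathcal{L}| - 1$ over all sets $\mathcal{L}$ of classes of lattices in $K^d$ with $\Lambda = \mathrm{PZ}(\mathcal{L})$. **Corollary.** Every closed order in $K^{2\times 2}$ has degree $0$, $1$ or $2$. The closed orders in $K^{2\times 2}$ of degree $0$ are exactly the maximal orders, the closed orders of degree $1$ are exactly the graduated orders that are not maximal (in particular, maximal orders and graduated orders are closed), and every non-graduated closed order in $K^{2\times 2}$ has degree $2$. -/

import Mathlib

open scoped Pointwise

/-!
Throughout, `O` is a discrete valuation ring with field of fractions `K`, that is, `K` is a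
discretely valued field and `O` is its valuation ring.
-/

namespace BolytropeOrders

section

variable (O : Type*) [CommRing O] (K : Type*) [Field K] [Algebra O K]

/-- The `O`-lattices in `K ^ d`: the finitely generated `O`-submodules that span `K ^ d` over `K`.
Over a discrete valuation ring these are exactly the free `O`-submodules of rank `d`. -/
def Lattice (d : ℕ) : Type _ :=
  {L : Submodule O (Fin d → K) // L.IsLattice K}

/-- Two lattices are homothetic if `L' = c L` for some `c ∈ K \ {0}`. -/
def homothety (d : ℕ) : Setoid (Lattice O K d) where
  r L L' := ∃ c : Kˣ, L'.1 = c • L.1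
  iseqv :=
    { refl := fun L => ⟨1, (one_smul _ _).symm⟩
      symm := by
        rintro L L' ⟨c, h⟩
        exact ⟨c⁻¹, by rw [h, inv_smul_smul]⟩
      trans := by
        rintro L L' L'' ⟨c, h⟩ ⟨c', h'⟩
        exact ⟨c' * c, by rw [h', h, mul_smul]⟩ }

/-- The vertices of the affine building of `SL_d(K)`: the homothety classes of lattices. -/
def Vertex (d : ℕ) : Type _ :=
  Quotient (homothety O K d)

variable {O K}

/-- The homothety class `[L]` of a lattice. -/
def Lattice.toVertex {d : ℕ} (L : Lattice O K d) : Vertex O K d :=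
  Quotient.mk (homothety O K d) L

/-- The endomorphism ring `End_O(L)` of a lattice `L`, inside the matrix ring `K ^ {d × d}`. -/
def Lattice.endRing {d : ℕ} (L : Lattice O K d) : Subalgebra O (Matrix (Fin d) (Fin d) K) where
  carrier := {X | ∀ v ∈ L.1, X.mulVec v ∈ L.1}
  mul_mem' := by
    intro X Y hX hY v hv
    rw [← Matrix.mulVec_mulVec]
    exact hX _ (hY v hv)
  add_mem' := by
    intro X Y hX hY v hv
    rw [Matrix.add_mulVec]
    exact L.1.add_mem (hX v hv) (hY v hv)
  algebraMap_mem' := by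
    intro a v hv
    rw [Algebra.algebraMap_eq_smul_one, Matrix.smul_mulVec, Matrix.one_mulVec]
    exact L.1.smul_mem a hv

theorem Lattice.endRing_le_of_homothetic {d : ℕ} {L L' : Lattice O K d}
    (h : ∃ c : Kˣ, L'.1 = c • L.1) : L.endRing ≤ L'.endRing := by
  obtain ⟨c, hc⟩ := h
  intro X hX v hv
  rw [hc] at hv ⊢
  obtain ⟨w, hw, rfl⟩ := hv
  refine ⟨X.mulVec w, hX w hw, ?_⟩
  exact (Matrix.mulVec_smul X c w).symm

/-- Homothetic lattices have the same endomorphism ring, which therefore depends only on the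
class of the lattice. -/
def Vertex.endRing {d : ℕ} (x : Vertex O K d) : Subalgebra O (Matrix (Fin d) (Fin d) K) :=
  Quotient.lift (s := homothety O K d) Lattice.endRing
    (fun _ _ h => le_antisymm (Lattice.endRing_le_of_homothetic h)
      (Lattice.endRing_le_of_homothetic ((homothety O K d).symm' h))) x

/-- An `O`-order in `K ^ {d × d}`: a subring that is also an `O`-lattice in `K ^ {d × d}`. -/
def IsOrder {d : ℕ} (Λ : Subalgebra O (Matrix (Fin d) (Fin d) K)) : Prop :=
  (Subalgebra.toSubmodule Λ).IsLattice K

/-- A maximal order: an order that is maximal, with respect to inclusion, among all orders. -/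
def IsMaximalOrder {d : ℕ} (Λ : Subalgebra O (Matrix (Fin d) (Fin d) K)) : Prop :=
  Maximal IsOrder Λ

/-- `L` is a `Λ`-lattice: it is stable under multiplication by `Λ`.
As `1 ∈ Λ`, this says `Λ L = L`. -/
def IsStable {d : ℕ} (Λ : Subalgebra O (Matrix (Fin d) (Fin d) K)) (L : Lattice O K d) : Prop :=
  ∀ X ∈ Λ, ∀ v ∈ L.1, X.mulVec v ∈ L.1

/-- `Q(Λ)`, the set of homothety classes of `Λ`-lattices. -/
def invariantClasses {d : ℕ} (Λ : Subalgebra O (Matrix (Fin d) (Fin d) K)) :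
    Set (Vertex O K d) :=
  {x | ∃ L : Lattice O K d, IsStable Λ L ∧ L.toVertex = x}

/-- `PZ(𝓛)`, the intersection of the endomorphism rings of the lattice classes in `𝓛`. -/
def PZ {d : ℕ} (𝓛 : Set (Vertex O K d)) : Subalgebra O (Matrix (Fin d) (Fin d) K) :=
  ⨅ x ∈ 𝓛, x.endRing

/-- A closed order: an order that is the intersection of the endomorphism rings of its
invariant lattices. -/
def IsClosedOrder {d : ℕ} (Λ : Subalgebra O (Matrix (Fin d) (Fin d) K)) : Prop :=
  IsOrder Λ ∧ Λ = PZ (invariantClasses Λ)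

/-- The degree of a closed order `Λ`: the minimum of `|𝓛| - 1` over the non-empty sets `𝓛` of
lattice classes with `Λ = PZ(𝓛)`. Infinite sets contribute the value `⊤` to the minimum. -/
noncomputable def degree {d : ℕ} (Λ : Subalgebra O (Matrix (Fin d) (Fin d) K)) : ℕ∞ :=
  sInf {n : ℕ∞ | ∃ 𝓛 : Set (Vertex O K d), 𝓛.Nonempty ∧ Λ = PZ 𝓛 ∧ n = 𝓛.encard - 1}

/-- A primitive idempotent of a ring: a nonzero idempotent that is not the sum of two nonzero
orthogonal idempotents. -/
def IsPrimitiveIdempotent {R : Type*} [Ring R] (e : R) : Prop :=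
  IsIdempotentElem e ∧ e ≠ 0 ∧
    ∀ f g : R, IsIdempotentElem f → IsIdempotentElem g → f * g = 0 → g * f = 0 → e = f + g →
      f = 0 ∨ g = 0

/-- A graduated order: an order that contains a complete set `ε₁, …, ε_d` of orthogonal primitive
idempotents of `K ^ {d × d}`. -/
def IsGraduatedOrder {d : ℕ} (Λ : Subalgebra O (Matrix (Fin d) (Fin d) K)) : Prop :=
  IsOrder Λ ∧ ∃ ε : Fin d → Matrix (Fin d) (Fin d) K,
    CompleteOrthogonalIdempotents ε ∧ (∀ i, IsPrimitiveIdempotent (ε i)) ∧ ∀ i, ε i ∈ Λ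

end

end BolytropeOrders

/-! Lattice classes in `K ^ 2` are the vertices of the Bruhat-Tits tree, and each endomorphism ring
is a conjugate `g M₂(O) g⁻¹`. An order has full rank, so it contains `ϖ ^ N M₂(O)`, and this
confines its stable classes to a ball (`distLE_of_smul_mem`).

The heart of the proof is that a bounded set of vertices can be replaced by three of its members
(`exists_three_of_bounded`). Take two members at maximal distance `D` and a basis in which they are
`O ⊕ O` and `O ⊕ ϖ ^ D O`. A matrix `Y` stabilising both has integral entries, with `Y 1 0`
divisible by `ϖ ^ D`. By maximality of `D`, any further member imposes on such a `Y` a single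
condition `(Y 1 1 - Y 0 0) τ ∈ O`. Such conditions are linearly ordered by the valuation of `τ`,
which is bounded below, so a third member with the strictest one accounts for all. Hence the degree
is at most 2.

Two vertices lie in a common apartment: by elementary divisors they have a common basis, whose
diagonal idempotents stabilise both (`isGraduatedOrder_of_eq_PZ_pair`). Conversely, in a suitable
basis a graduated order is given by its Peirce components `O`, `ϖ ^ m O`, `ϖ ^ n O`, `O`, and two
lattices suffice to impose these (`IsGraduatedOrder.exists_pair`). One vertex gives a maximal order,
because every order stabilises a lattice and an inclusion between two endomorphism rings is an
equality (`isMaximalOrder_iff`). Only degree 2 is left for a closed order that is not graduated. -/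

namespace BolytropeOrders

/-- A `2 × 2` matrix over `K` is integral if its entries lie in `O`. -/
def IsIntegralMatrix (O : Type*) [CommRing O] {K : Type*} [Field K] [Algebra O K]
    (X : Matrix (Fin 2) (Fin 2) K) : Prop :=
  ∀ i j, X i j ∈ (algebraMap O K).range

/-! ### Integral matrices, and lattices as column spans -/

section

variable {O : Type*} [CommRing O] {K : Type*} [Field K] [Algebra O K]

theorem isIntegralMatrix_one : IsIntegralMatrix O (1 : Matrix (Fin 2) (Fin 2) K) := by
  intro i j
  rw [Matrix.one_apply]
  split_ifs
  · exact one_mem _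
  · exact zero_mem _

theorem isIntegralMatrix_single (i j : Fin 2) :
    IsIntegralMatrix O (Matrix.single i j (1 : K)) := by
  intro a b
  rw [Matrix.single_apply]
  split_ifs
  · exact one_mem _
  · exact zero_mem _

theorem IsIntegralMatrix.mul {X Y : Matrix (Fin 2) (Fin 2) K} (hX : IsIntegralMatrix O X)
    (hY : IsIntegralMatrix O Y) : IsIntegralMatrix O (X * Y) := fun i j => by
  rw [Matrix.mul_apply]
  exact sum_mem fun k _ => mul_mem (hX i k) (hY k j)

theorem IsIntegralMatrix.mulVec {X : Matrix (Fin 2) (Fin 2) K} {v : Fin 2 → K}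
    (hX : IsIntegralMatrix O X) (hv : ∀ i, v i ∈ (algebraMap O K).range) (i : Fin 2) :
    X.mulVec v i ∈ (algebraMap O K).range := by
  rw [Matrix.mulVec, dotProduct]
  exact sum_mem fun k _ => mul_mem (hX i k) (hv k)

theorem IsIntegralMatrix.smul {X : Matrix (Fin 2) (Fin 2) K} (hX : IsIntegralMatrix O X)
    {c : K} (hc : c ∈ (algebraMap O K).range) : IsIntegralMatrix O (c • X) := fun i j =>
  mul_mem hc (hX i j)

theorem isIntegralMatrix_iff (X : Matrix (Fin 2) (Fin 2) K) :
    IsIntegralMatrix O X ↔ X 0 0 ∈ (algebraMap O K).range ∧ X 0 1 ∈ (algebraMap O K).range ∧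
      X 1 0 ∈ (algebraMap O K).range ∧ X 1 1 ∈ (algebraMap O K).range := by
  constructor
  · intro h
    exact ⟨h 0 0, h 0 1, h 1 0, h 1 1⟩
  · rintro ⟨h1, h2, h3, h4⟩ i j
    fin_cases i <;> fin_cases j <;> assumption

variable (O) in
/-- The `O`-span of the columns of an invertible matrix. -/
def columnSpan (g : GL (Fin 2) K) : Submodule O (Fin 2 → K) :=
  Submodule.span O (Set.range fun j => (g : Matrix (Fin 2) (Fin 2) K).col j)

theorem mem_columnSpan {g : GL (Fin 2) K} {v : Fin 2 → K} :
    v ∈ columnSpan O g ↔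
      ∀ i, (↑g⁻¹ : Matrix (Fin 2) (Fin 2) K).mulVec v i ∈ (algebraMap O K).range := by
  have key : v ∈ columnSpan O g ↔ ∃ a : Fin 2 → O,
      v = (g : Matrix (Fin 2) (Fin 2) K).mulVec (fun i => algebraMap O K (a i)) := by
    rw [columnSpan, Submodule.mem_span_range_iff_exists_fun]
    refine exists_congr fun a => ?_
    rw [eq_comm]
    have : ∑ i, a i • (g : Matrix (Fin 2) (Fin 2) K).col i =
        (g : Matrix (Fin 2) (Fin 2) K).mulVec (fun i => algebraMap O K (a i)) := by
      ext j
      simp [Matrix.mulVec, dotProduct, Algebra.smul_def, mul_comm]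
    rw [this]
  rw [key]
  constructor
  · rintro ⟨a, rfl⟩ i
    rw [Matrix.mulVec_mulVec, ← Units.val_mul, inv_mul_cancel, Units.val_one, Matrix.one_mulVec]
    exact ⟨a i, rfl⟩
  · intro h
    choose a ha using h
    refine ⟨a, ?_⟩
    rw [funext ha, Matrix.mulVec_mulVec, ← Units.val_mul, mul_inv_cancel, Units.val_one,
      Matrix.one_mulVec]

variable (O) in
/-- The lattice spanned by the columns of an invertible matrix. -/
def latticeOf (g : GL (Fin 2) K) : Lattice O K 2 :=
  ⟨columnSpan O g, by
    refine ⟨Submodule.fg_span (Set.finite_range _), ?_⟩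
    rw [columnSpan, Submodule.span_span_of_tower]
    have h : LinearIndependent K (g : Matrix (Fin 2) (Fin 2) K).col :=
      Matrix.linearIndependent_cols_iff_isUnit.2 g.isUnit
    exact h.span_eq_top_of_card_eq_finrank (by simp)⟩

/-- The conjugate `g⁻¹ X g` is the matrix of `X` in the basis of the lattice formed by the columns
of `g`. -/
theorem mem_endRing_latticeOf {g : GL (Fin 2) K} {X : Matrix (Fin 2) (Fin 2) K} :
    X ∈ (latticeOf O g).endRing ↔
      IsIntegralMatrix O ((↑g⁻¹ : Matrix (Fin 2) (Fin 2) K) * X * (g : Matrix (Fin 2) (Fin 2) K)) := by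
  change (∀ v ∈ columnSpan O g, X.mulVec v ∈ columnSpan O g) ↔ _
  constructor
  · intro h i j
    have h1 : (g : Matrix (Fin 2) (Fin 2) K).col j ∈ columnSpan O g :=
      Submodule.subset_span ⟨j, rfl⟩
    have h2 := mem_columnSpan.1 (h _ h1) i
    rw [Matrix.mulVec_mulVec] at h2
    exact h2
  · intro h v hv
    rw [mem_columnSpan] at hv ⊢
    intro i
    have h1 : (↑g⁻¹ : Matrix (Fin 2) (Fin 2) K).mulVec (X.mulVec v) =
        ((↑g⁻¹ : Matrix (Fin 2) (Fin 2) K) * X * (g : Matrix (Fin 2) (Fin 2) K)).mulVec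
          ((↑g⁻¹ : Matrix (Fin 2) (Fin 2) K).mulVec v) := by
      rw [Matrix.mulVec_mulVec, Matrix.mulVec_mulVec, Matrix.mul_assoc, Matrix.mul_assoc,
        ← Units.val_mul, mul_inv_cancel, Units.val_one, Matrix.mul_one]
    rw [h1]
    exact h.mulVec hv i

variable [IsDomain O] [IsDiscreteValuationRing O] [IsFractionRing O K]

theorem exists_eq_latticeOf (L : Lattice O K 2) : ∃ g : GL (Fin 2) K, L = latticeOf O g := by
  obtain ⟨L, hL⟩ := L
  have htf : Module.IsTorsionFree O K := inferInstance
  have hfree : Module.Free O L := Submodule.IsLattice.free K L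
  have hrank : Module.finrank O L = 2 := by
    simpa using Submodule.IsLattice.finrank_of_pi K L
  let b : Module.Basis (Fin 2) O L := Module.finBasisOfFinrankEq O L hrank
  let M : Matrix (Fin 2) (Fin 2) K := Matrix.of fun i j => (b j : Fin 2 → K) i
  have hcol : ∀ j, M.col j = (b j : Fin 2 → K) := fun j => rfl
  have hM : IsUnit M := by
    rw [← Matrix.linearIndependent_cols_iff_isUnit]
    have h : M.col = b.extendOfIsLattice K := by
      ext j : 1
      rw [hcol, Module.Basis.extendOfIsLattice_apply]
    rw [h]
    exact (b.extendOfIsLattice K).linearIndependent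
  refine ⟨hM.unit, Subtype.ext ?_⟩
  change L = columnSpan O hM.unit
  rw [columnSpan]
  have h2 : (Set.range fun j => (hM.unit : Matrix (Fin 2) (Fin 2) K).col j) =
      L.subtype '' Set.range b := by
    rw [← Set.range_comp]
    rfl
  rw [h2, ← Submodule.map_span, b.span_eq, Submodule.map_top, Submodule.range_subtype]

theorem Vertex.exists_endRing_eq (x : Vertex O K 2) :
    ∃ g : GL (Fin 2) K, x.endRing = (latticeOf O g).endRing := by
  induction x using Quotient.inductionOn with
  | h L =>
    obtain ⟨g, rfl⟩ := exists_eq_latticeOf L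
    exact ⟨g, rfl⟩

end

/-! ### Closure under stable lattices -/

section

variable {O : Type*} [CommRing O] {K : Type*} [Field K] [Algebra O K]

theorem mem_invariantClasses {d : ℕ} {Λ : Subalgebra O (Matrix (Fin d) (Fin d) K)}
    {x : Vertex O K d} : x ∈ invariantClasses Λ ↔ Λ ≤ x.endRing := by
  induction x using Quotient.inductionOn with
  | h L =>
    constructor
    · rintro ⟨L', h, h'⟩
      rw [show (Quotient.mk _ L : Vertex O K d) = L'.toVertex from h'.symm]
      exact h
    · intro h
      exact ⟨L, h, rfl⟩

theorem mem_PZ {d : ℕ} {𝓛 : Set (Vertex O K d)} {X : Matrix (Fin d) (Fin d) K} :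
    X ∈ PZ 𝓛 ↔ ∀ x ∈ 𝓛, X ∈ x.endRing := by
  simp [PZ, Algebra.mem_iInf]

/-- `PZ` and `invariantClasses` form an antitone Galois connection, so every value of `PZ` is fixed
by the closure. This is how orders are shown to be closed. -/
theorem eq_PZ_invariantClasses_of_eq_PZ {d : ℕ} {Λ : Subalgebra O (Matrix (Fin d) (Fin d) K)}
    {𝓛 : Set (Vertex O K d)} (h : Λ = PZ 𝓛) : Λ = PZ (invariantClasses Λ) := by
  refine le_antisymm ?_ ?_
  · intro X hX
    rw [mem_PZ]
    exact fun x hx => mem_invariantClasses.1 hx hX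
  · intro X hX
    rw [mem_PZ] at hX
    rw [h, mem_PZ]
    refine fun x hx => hX x (mem_invariantClasses.2 fun Y hY => ?_)
    rw [h, mem_PZ] at hY
    exact hY x hx

/-- An order stabilises some lattice. -/
theorem IsOrder.exists_isStable {d : ℕ} {Λ : Subalgebra O (Matrix (Fin d) (Fin d) K)}
    (hΛ : IsOrder Λ) : ∃ L : Lattice O K d, IsStable Λ L := by
  let B : Matrix (Fin d) (Fin d) K →ₗ[O] (Fin d → K) →ₗ[O] (Fin d → K) :=
    LinearMap.mk₂ O (fun X v => X.mulVec v) (fun X Y v => Matrix.add_mulVec X Y v)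
      (fun a X v => Matrix.smul_mulVec a X v) (fun X v w => Matrix.mulVec_add X v w)
      (fun a X v => Matrix.mulVec_smul X a v)
  let L₀ : Submodule O (Fin d → K) :=
    Submodule.span O (Set.range fun i : Fin d => (Pi.single i 1 : Fin d → K))
  -- The lattice `Λ L₀` generated from the standard one; it contains `L₀` because `1 ∈ Λ`.
  let L : Submodule O (Fin d → K) := Submodule.map₂ B (Subalgebra.toSubmodule Λ) L₀
  have hle : L₀ ≤ L := by
    intro v hv
    have := Submodule.apply_mem_map₂ B ((Subalgebra.mem_toSubmodule Λ).2 (one_mem Λ)) hv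
    simpa [B] using this
  have hL : L.IsLattice K := by
    refine ⟨Submodule.FG.map₂ B hΛ.fg (Submodule.fg_span (Set.finite_range _)), ?_⟩
    rw [eq_top_iff]
    refine le_trans ?_ (Submodule.span_mono hle)
    rw [Submodule.span_span_of_tower, ← (Pi.basisFun K (Fin d)).span_eq]
    refine Submodule.span_mono ?_
    rintro _ ⟨i, rfl⟩
    exact ⟨i, by simp⟩
  refine ⟨⟨L, hL⟩, fun X hX v hv => ?_⟩
  change X.mulVec v ∈ L
  have hsub : L ≤ L.comap (B X) := by
    refine Submodule.map₂_le.2 fun Y hY w hw => ?_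
    rw [Submodule.mem_comap]
    have := Submodule.apply_mem_map₂ B ((Subalgebra.mem_toSubmodule Λ).2 (mul_mem hX hY)) hw
    simpa [B, Matrix.mulVec_mulVec] using this
  exact hsub hv

end

/-! ### Distance in the tree -/

section

variable {O : Type*} [CommRing O] {K : Type*} [Field K] [Algebra O K]

/-- For a uniformizer `ϖ`, the classes of the lattices spanned by the columns of `g` and of `h`
have distance at most `n` in the Bruhat-Tits tree. -/
def DistLE (ϖ : O) (g h : GL (Fin 2) K) (n : ℕ) : Prop :=
  ∃ c : K, c ≠ 0 ∧ IsIntegralMatrix O (c • ((g⁻¹ * h : GL (Fin 2) K) : Matrix (Fin 2) (Fin 2) K)) ∧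
    IsIntegralMatrix O ((algebraMap O K ϖ ^ n * c⁻¹) •
      ((h⁻¹ * g : GL (Fin 2) K) : Matrix (Fin 2) (Fin 2) K))

/-- The matrix with columns `(1, t)` and `(0, q)`. -/
def lowerGL (t q : K) (hq : q ≠ 0) : GL (Fin 2) K where
  val := !![1, 0; t, q]
  inv := !![1, 0; -(t / q), q⁻¹]
  val_inv := by
    ext i j
    fin_cases i <;> fin_cases j <;> simp [Matrix.mul_apply, Fin.sum_univ_two] <;> field_simp
    ring
  inv_val := by
    ext i j
    fin_cases i <;> fin_cases j <;> simp [Matrix.mul_apply, Fin.sum_univ_two] <;> field_simp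
    ring

theorem coe_lowerGL (t q : K) (hq : q ≠ 0) :
    (lowerGL t q hq : Matrix (Fin 2) (Fin 2) K) = !![1, 0; t, q] := rfl

theorem coe_inv_lowerGL (t q : K) (hq : q ≠ 0) :
    ((lowerGL t q hq)⁻¹ : GL (Fin 2) K) = (!![1, 0; -(t / q), q⁻¹] : Matrix (Fin 2) (Fin 2) K) :=
  rfl

variable {ϖ : O}

theorem DistLE.trans {g h k : GL (Fin 2) K} {m n : ℕ} (h1 : DistLE ϖ g h m)
    (h2 : DistLE ϖ h k n) : DistLE ϖ g k (m + n) := by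
  obtain ⟨c, hc, h3, h4⟩ := h1
  obtain ⟨c', hc', h5, h6⟩ := h2
  refine ⟨c * c', mul_ne_zero hc hc', ?_, ?_⟩
  · have h7 := h3.mul h5
    rw [smul_mul_smul_comm, ← Units.val_mul] at h7
    rwa [show g⁻¹ * k = g⁻¹ * h * (h⁻¹ * k) by group]
  · have h7 := h6.mul h4
    rw [smul_mul_smul_comm, ← Units.val_mul] at h7
    rw [show k⁻¹ * g = k⁻¹ * h * (h⁻¹ * g) by group]
    convert h7 using 2
    rw [mul_inv, pow_add]
    ring

theorem DistLE.symm (hϖ : algebraMap O K ϖ ≠ 0) {g h : GL (Fin 2) K} {n : ℕ}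
    (h1 : DistLE ϖ g h n) : DistLE ϖ h g n := by
  obtain ⟨c, hc, h3, h4⟩ := h1
  refine ⟨_, mul_ne_zero (pow_ne_zero n hϖ) (inv_ne_zero hc), h4, ?_⟩
  convert h3 using 2
  field_simp

theorem DistLE.mono {g h : GL (Fin 2) K} {m n : ℕ} (h1 : DistLE ϖ g h m) (hmn : m ≤ n) :
    DistLE ϖ g h n := by
  obtain ⟨c, hc, h3, h4⟩ := h1
  refine ⟨c, hc, h3, ?_⟩
  have h5 := h4.smul (c := algebraMap O K ϖ ^ (n - m)) (pow_mem (RingHom.mem_range_self _ ϖ) _)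
  rw [smul_smul, ← mul_assoc, ← pow_add, Nat.sub_add_cancel hmn] at h5
  exact h5

theorem distLE_mul_left_iff (k : GL (Fin 2) K) {g h : GL (Fin 2) K} {n : ℕ} :
    DistLE ϖ (k * g) (k * h) n ↔ DistLE ϖ g h n := by
  rw [DistLE, DistLE, show (k * g)⁻¹ * (k * h) = g⁻¹ * h by group,
    show (k * h)⁻¹ * (k * g) = h⁻¹ * g by group]

theorem DistLE.endRing_le {g h : GL (Fin 2) K} (h1 : DistLE ϖ g h 0) :
    (latticeOf O g).endRing ≤ (latticeOf O h).endRing := by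
  obtain ⟨c, hc, h3, h4⟩ := h1
  intro X hX
  rw [mem_endRing_latticeOf] at hX ⊢
  have h5 := (h4.mul hX).mul h3
  rw [pow_zero, one_mul, smul_mul_assoc, smul_mul_assoc, mul_smul_comm, smul_smul,
    inv_mul_cancel₀ hc, one_smul] at h5
  convert h5 using 1
  simp only [Units.val_mul, Matrix.mul_assoc]
  rw [Units.mul_inv_cancel_left, Units.mul_inv_cancel_left]

theorem DistLE.endRing_eq (hϖ : algebraMap O K ϖ ≠ 0) {g h : GL (Fin 2) K}
    (h1 : DistLE ϖ g h 0) : (latticeOf O g).endRing = (latticeOf O h).endRing :=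
  le_antisymm h1.endRing_le (h1.symm hϖ).endRing_le

/-- A column operation from `GL₂(O)` does not change the lattice, and a scalar does not change its
class. All normal forms below are reached through this criterion. -/
theorem distLE_zero_of_eq_smul_mul {g h : GL (Fin 2) K} (U : Matrix (Fin 2) (Fin 2) K)
    (hU : IsIntegralMatrix O U) (hdet : U.det ≠ 0) (hdet' : U.det⁻¹ ∈ (algebraMap O K).range)
    {c : K} (hc : c ≠ 0) (hgh : (h : Matrix (Fin 2) (Fin 2) K) = c • (g * U)) :
    DistLE ϖ g h 0 := by
  have h1 : ((g⁻¹ * h : GL (Fin 2) K) : Matrix (Fin 2) (Fin 2) K) = c • U := by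
    rw [Units.val_mul, hgh, mul_smul_comm, Units.inv_mul_cancel_left]
  have h2 : ((h⁻¹ * g : GL (Fin 2) K) : Matrix (Fin 2) (Fin 2) K) = c⁻¹ • U⁻¹ := by
    rw [show h⁻¹ * g = (g⁻¹ * h)⁻¹ by group, Matrix.coe_units_inv, h1]
    refine Matrix.inv_eq_left_inv ?_
    rw [smul_mul_smul_comm, inv_mul_cancel₀ hc, one_smul,
      Matrix.nonsing_inv_mul _ (isUnit_iff_ne_zero.2 hdet)]
  refine ⟨c⁻¹, inv_ne_zero hc, ?_, ?_⟩
  · rwa [h1, smul_smul, inv_mul_cancel₀ hc, one_smul]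
  · rw [h2, smul_smul, pow_zero, one_mul, inv_inv, mul_inv_cancel₀ hc, one_smul, Matrix.inv_def,
      Ring.inverse_eq_inv']
    refine IsIntegralMatrix.smul ?_ hdet'
    rw [Matrix.adjugate_fin_two, isIntegralMatrix_iff]
    exact ⟨hU 1 1, neg_mem (hU 0 1), neg_mem (hU 1 0), hU 0 0⟩

theorem conj_mem_endRing_mul_iff (k h : GL (Fin 2) K) (Y : Matrix (Fin 2) (Fin 2) K) :
    (k : Matrix (Fin 2) (Fin 2) K) * Y * (↑k⁻¹ : Matrix (Fin 2) (Fin 2) K) ∈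
      (latticeOf O (k * h)).endRing ↔ Y ∈ (latticeOf O h).endRing := by
  rw [mem_endRing_latticeOf, mem_endRing_latticeOf, mul_inv_rev]
  simp only [Units.val_mul, Matrix.mul_assoc]
  rw [Units.inv_mul_cancel_left, Units.inv_mul_cancel_left]

/-- These are the four entries of the conjugated matrix. The third one, which involves `Y 1 1 - Y 0
0`, carries the argument about three lattices. -/
theorem mem_endRing_lowerGL_iff {t q : K} (hq : q ≠ 0) (Y : Matrix (Fin 2) (Fin 2) K) :
    Y ∈ (latticeOf O (lowerGL t q hq)).endRing ↔
      Y 0 0 + Y 0 1 * t ∈ (algebraMap O K).range ∧ Y 0 1 * q ∈ (algebraMap O K).range ∧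
      (Y 1 0 + (Y 1 1 - Y 0 0) * t - Y 0 1 * t ^ 2) / q ∈ (algebraMap O K).range ∧
      Y 1 1 - Y 0 1 * t ∈ (algebraMap O K).range := by
  rw [mem_endRing_latticeOf, isIntegralMatrix_iff, coe_lowerGL, coe_inv_lowerGL]
  simp only [Matrix.mul_apply, Fin.sum_univ_two, Matrix.of_apply, Matrix.cons_val', Matrix.cons_val_zero,
    Matrix.cons_val_one, Matrix.cons_val_fin_one]
  have e1 : (1 * Y 0 0 + 0 * Y 1 0) * 1 + (1 * Y 0 1 + 0 * Y 1 1) * t = Y 0 0 + Y 0 1 * t := by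
    ring
  have e2 : (1 * Y 0 0 + 0 * Y 1 0) * 0 + (1 * Y 0 1 + 0 * Y 1 1) * q = Y 0 1 * q := by ring
  have e3 : (-(t / q) * Y 0 0 + q⁻¹ * Y 1 0) * 1 + (-(t / q) * Y 0 1 + q⁻¹ * Y 1 1) * t =
      (Y 1 0 + (Y 1 1 - Y 0 0) * t - Y 0 1 * t ^ 2) / q := by
    field_simp
    ring
  have e4 : (-(t / q) * Y 0 0 + q⁻¹ * Y 1 0) * 0 + (-(t / q) * Y 0 1 + q⁻¹ * Y 1 1) * q =
      Y 1 1 - Y 0 1 * t := by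
    field_simp
    ring
  rw [e1, e2, e3, e4]

theorem mem_endRing_one_iff (Y : Matrix (Fin 2) (Fin 2) K) :
    Y ∈ (latticeOf O (1 : GL (Fin 2) K)).endRing ↔ IsIntegralMatrix O Y := by
  rw [mem_endRing_latticeOf, inv_one, Units.val_one, Matrix.one_mul, Matrix.mul_one]

theorem conj_mem_endRing_iff (k : GL (Fin 2) K) (Y : Matrix (Fin 2) (Fin 2) K) :
    (k : Matrix (Fin 2) (Fin 2) K) * Y * (↑k⁻¹ : Matrix (Fin 2) (Fin 2) K) ∈
      (latticeOf O k).endRing ↔ IsIntegralMatrix O Y := by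
  have h := conj_mem_endRing_mul_iff (O := O) k 1 Y
  rwa [mul_one, mem_endRing_one_iff] at h

theorem algebraMap_ne_zero_of_irreducible [IsFractionRing O K] (hϖ : Irreducible ϖ) :
    algebraMap O K ϖ ≠ 0 := by
  intro h
  exact hϖ.ne_zero ((map_eq_zero_iff _ (IsFractionRing.injective O K)).1 h)

theorem exists_eq_pow_mul_unit [IsDomain O] [IsDiscreteValuationRing O] (hϖ : Irreducible ϖ) {x : K}
    (hx : x ≠ 0) (hxO : x ∈ (algebraMap O K).range) :
    ∃ (n : ℕ) (u : Oˣ), x = algebraMap O K ϖ ^ n * algebraMap O K u := by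
  obtain ⟨y, rfl⟩ := hxO
  have hy : y ≠ 0 := by
    rintro rfl
    exact hx (map_zero _)
  obtain ⟨n, u, rfl⟩ := IsDiscreteValuationRing.eq_unit_mul_pow_irreducible hy hϖ
  exact ⟨n, u, by rw [map_mul, map_pow, mul_comm]⟩

theorem inv_algebraMap_unit_mem (u : Oˣ) : (algebraMap O K u)⁻¹ ∈ (algebraMap O K).range :=
  ⟨(↑u⁻¹ : O), eq_inv_of_mul_eq_one_left (by rw [← map_mul, Units.inv_mul, map_one])⟩

theorem le_of_pow_div_pow_mem [IsDomain O] [IsFractionRing O K] (hϖ : Irreducible ϖ) {m n : ℕ}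
    (h : algebraMap O K ϖ ^ m / algebraMap O K ϖ ^ n ∈ (algebraMap O K).range) : n ≤ m := by
  obtain ⟨x, hx⟩ := h
  have h0 := algebraMap_ne_zero_of_irreducible (K := K) hϖ
  rw [eq_div_iff (pow_ne_zero n h0), ← map_pow, ← map_pow, ← map_mul] at hx
  have h1 : ϖ ^ n ∣ ϖ ^ m := ⟨x, by
    rw [← IsFractionRing.injective O K hx, mul_comm]⟩
  exact (pow_dvd_pow_iff hϖ.ne_zero hϖ.not_isUnit).1 h1

theorem distLE_lowerGL_pow [IsFractionRing O K] (hϖ : Irreducible ϖ) (k : GL (Fin 2) K)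
    (n : ℕ) :
    DistLE ϖ k (k * lowerGL 0 (algebraMap O K ϖ ^ n)
        (pow_ne_zero n (algebraMap_ne_zero_of_irreducible hϖ))) n := by
  have h0 := pow_ne_zero n (algebraMap_ne_zero_of_irreducible (K := K) hϖ)
  refine ⟨1, one_ne_zero, ?_, ?_⟩
  · rw [inv_mul_cancel_left, one_smul, coe_lowerGL, isIntegralMatrix_iff]
    exact ⟨one_mem _, zero_mem _, zero_mem _, pow_mem (RingHom.mem_range_self _ ϖ) n⟩
  · rw [show ∀ l : GL (Fin 2) K, (k * l)⁻¹ * k = l⁻¹ by intro l; group, coe_inv_lowerGL,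
      isIntegralMatrix_iff]
    simp only [inv_one, mul_one, Matrix.smul_apply, Matrix.of_apply, Matrix.cons_val',
      Matrix.cons_val_zero, Matrix.cons_val_one, Matrix.cons_val_fin_one, smul_eq_mul, zero_div,
      neg_zero, mul_zero, mul_inv_cancel₀ h0]
    exact ⟨pow_mem (RingHom.mem_range_self _ ϖ) n, zero_mem _, zero_mem _, one_mem _⟩

/-- One diagonal entry from each of the two integrality conditions is used; in their product the
unknown scalar `c` cancels and `ϖ ^ m / ϖ ^ n` remains. -/
theorem le_of_distLE_lowerGL_pow [IsDomain O] [IsFractionRing O K] (hϖ : Irreducible ϖ)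
    {k : GL (Fin 2) K} {m n : ℕ}
    (h : DistLE ϖ k (k * lowerGL 0 (algebraMap O K ϖ ^ n)
        (pow_ne_zero n (algebraMap_ne_zero_of_irreducible hϖ))) m) : n ≤ m := by
  obtain ⟨c, hc, h1, h2⟩ := h
  rw [inv_mul_cancel_left, coe_lowerGL] at h1
  rw [show ∀ l : GL (Fin 2) K, (k * l)⁻¹ * k = l⁻¹ by intro l; group, coe_inv_lowerGL] at h2
  have h3 := h1 0 0
  have h4 := h2 1 1
  simp at h3 h4
  have h5 := mul_mem (RingHom.mem_range.2 h3) (RingHom.mem_range.2 h4)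
  refine le_of_pow_div_pow_mem (K := K) hϖ ?_
  convert h5 using 1
  field_simp

end

/-! ### Normal forms for one and two lattices -/

section

variable {O : Type*} [CommRing O] [IsDomain O] [IsDiscreteValuationRing O]
  {K : Type*} [Field K] [Algebra O K] [IsFractionRing O K] {ϖ : O}

theorem mem_range_or_inv_mem_range (x : K) :
    x ∈ (algebraMap O K).range ∨ x⁻¹ ∈ (algebraMap O K).range :=
  ValuationRing.isInteger_or_isInteger O x

theorem algebraMap_unit_ne_zero (u : Oˣ) : algebraMap O K u ≠ 0 := by
  intro h
  exact u.ne_zero ((map_eq_zero_iff _ (IsFractionRing.injective O K)).1 h)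

/-- Hermite normal form, up to homothety. -/
theorem exists_distLE_lowerGL (ϖ : O) (h : GL (Fin 2) K) :
    ∃ (t q : K) (hq : q ≠ 0), DistLE ϖ (lowerGL t q hq) h 0 := by
  set a := (h : Matrix (Fin 2) (Fin 2) K) 0 0 with ha
  set b := (h : Matrix (Fin 2) (Fin 2) K) 0 1 with hb
  set c := (h : Matrix (Fin 2) (Fin 2) K) 1 0 with hc
  set d := (h : Matrix (Fin 2) (Fin 2) K) 1 1 with hd
  have hM : (h : Matrix (Fin 2) (Fin 2) K) = !![a, b; c, d] := Matrix.eta_fin_two _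
  have hdet : a * d - b * c ≠ 0 := by
    have h1 := ((Matrix.isUnit_iff_isUnit_det _).1 h.isUnit).ne_zero
    rwa [Matrix.det_fin_two] at h1
  -- The entry of the first row with the smaller valuation serves as pivot to clear the other one.
  by_cases hcase : a ≠ 0 ∧ b / a ∈ (algebraMap O K).range
  · obtain ⟨ha0, hba⟩ := hcase
    refine ⟨c / a, (a * d - b * c) / a ^ 2, div_ne_zero hdet (pow_ne_zero 2 ha0), ?_⟩
    refine distLE_zero_of_eq_smul_mul !![1, b / a; 0, 1] ?_ ?_ ?_ ha0 ?_
    · rw [isIntegralMatrix_iff]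
      exact ⟨one_mem _, hba, zero_mem _, one_mem _⟩
    · simp [Matrix.det_fin_two]
    · simp [Matrix.det_fin_two]
    · rw [hM, coe_lowerGL]
      ext i j
      fin_cases i <;> fin_cases j <;> simp <;> field_simp
      ring
  · have hb0 : b ≠ 0 := by
      intro hb0
      refine hcase ⟨?_, ?_⟩
      · intro ha0
        rw [ha0, hb0] at hdet
        simp at hdet
      · rw [hb0, zero_div]
        exact zero_mem _
    have hab : a / b ∈ (algebraMap O K).range := by
      rcases mem_range_or_inv_mem_range (O := O) (a / b) with h1 | h1
      · exact h1
      · rw [inv_div] at h1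
        by_cases ha0 : a = 0
        · rw [ha0, zero_div]
          exact zero_mem _
        · exact absurd ⟨ha0, h1⟩ hcase
    refine ⟨d / b, (a * d - b * c) / b ^ 2, div_ne_zero hdet (pow_ne_zero 2 hb0), ?_⟩
    refine distLE_zero_of_eq_smul_mul !![a / b, 1; -1, 0] ?_ ?_ ?_ hb0 ?_
    · rw [isIntegralMatrix_iff]
      exact ⟨hab, one_mem _, neg_mem (one_mem _), zero_mem _⟩
    · simp [Matrix.det_fin_two]
    · simp [Matrix.det_fin_two]
    · rw [hM, coe_lowerGL]
      ext i j
      fin_cases i <;> fin_cases j <;> simp <;> field_simp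
      ring

/-- Diagonalisation of `!![1, 0; t, q]` with an entry of least valuation among `1`, `t`, `q` as
pivot. The pivot becomes the homothety factor, so the remaining diagonal entry `r` is integral. -/
theorem exists_distLE_diagonal_lowerGL (ϖ : O) {t q : K} (hq : q ≠ 0) :
    ∃ (k : GL (Fin 2) K) (r : K) (hr : r ≠ 0), r ∈ (algebraMap O K).range ∧ DistLE ϖ 1 k 0 ∧
      DistLE ϖ (k * lowerGL 0 r hr) (lowerGL t q hq) 0 := by
  -- The row operation `A` has determinant 1, so it fixes the standard lattice and can serve as `k`.
  have key : ∀ (A U : Matrix (Fin 2) (Fin 2) K) (c r : K) (hr : r ≠ 0), IsIntegralMatrix O A →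
      A.det = 1 → IsIntegralMatrix O U → U.det = 1 → c ≠ 0 → r ∈ (algebraMap O K).range →
      !![1, 0; t, q] = c • (A * !![1, 0; 0, r] * U) →
      ∃ (k : GL (Fin 2) K) (r : K) (hr : r ≠ 0), r ∈ (algebraMap O K).range ∧ DistLE ϖ 1 k 0 ∧
        DistLE ϖ (k * lowerGL 0 r hr) (lowerGL t q hq) 0 := by
    intro A U c r hr hA hA1 hU hU1 hc hrO hAU
    refine ⟨Matrix.GeneralLinearGroup.mkOfDetNeZero A (by rw [hA1]; exact one_ne_zero), r, hr,
      hrO, ?_, ?_⟩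
    · refine distLE_zero_of_eq_smul_mul A hA ?_ ?_ one_ne_zero ?_
      · rw [hA1]
        exact one_ne_zero
      · rw [hA1, inv_one]
        exact one_mem _
      · rw [one_smul, Units.val_one, Matrix.one_mul]
        rfl
    · refine distLE_zero_of_eq_smul_mul U hU ?_ ?_ hc ?_
      · rw [hU1]
        exact one_ne_zero
      · rw [hU1, inv_one]
        exact one_mem _
      · exact hAU
  by_cases h1 : t / q ∈ (algebraMap O K).range
  · rcases mem_range_or_inv_mem_range (O := O) q with h2 | h2
    · refine key 1 !![1, 0; t / q, 1] 1 q hq isIntegralMatrix_one Matrix.det_one ?_ ?_ one_ne_zero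
        h2 ?_
      · rw [isIntegralMatrix_iff]
        exact ⟨one_mem _, zero_mem _, h1, one_mem _⟩
      · simp [Matrix.det_fin_two]
      · ext i j
        fin_cases i <;> fin_cases j <;> simp
        field_simp
    · refine key !![0, -1; 1, 0] !![t / q, 1; -1, 0] q q⁻¹ (inv_ne_zero hq) ?_ ?_ ?_ ?_ hq h2 ?_
      · rw [isIntegralMatrix_iff]
        exact ⟨zero_mem _, neg_mem (one_mem _), one_mem _, zero_mem _⟩
      · simp [Matrix.det_fin_two]
      · rw [isIntegralMatrix_iff]
        exact ⟨h1, one_mem _, neg_mem (one_mem _), zero_mem _⟩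
      · simp [Matrix.det_fin_two]
      · ext i j
        fin_cases i <;> fin_cases j <;> simp <;> field_simp
  · have ht : t ≠ 0 := by
      rintro rfl
      rw [zero_div] at h1
      exact h1 (zero_mem _)
    have h2 : q / t ∈ (algebraMap O K).range := by
      rcases mem_range_or_inv_mem_range (O := O) (t / q) with h2 | h2
      · exact absurd h2 h1
      · rwa [inv_div] at h2
    rcases mem_range_or_inv_mem_range (O := O) t with h3 | h3
    · refine key !![1, 0; t, 1] 1 1 q hq ?_ ?_ isIntegralMatrix_one Matrix.det_one one_ne_zero
        ?_ ?_
      · rw [isIntegralMatrix_iff]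
        exact ⟨one_mem _, zero_mem _, h3, one_mem _⟩
      · simp [Matrix.det_fin_two]
      · have h4 := mul_mem h2 h3
        rwa [div_mul_cancel₀ _ ht] at h4
      · ext i j
        fin_cases i <;> fin_cases j <;> simp
    -- Here `t` is the pivot; comparing determinants forces `r = q / t ^ 2`.
    · refine key !![t⁻¹, -1; 1, 0] !![1, q / t; 0, 1] t (q / t * t⁻¹)
        (mul_ne_zero (div_ne_zero hq ht) (inv_ne_zero ht)) ?_ ?_ ?_ ?_ ht (mul_mem h2 h3) ?_
      · rw [isIntegralMatrix_iff]
        exact ⟨h3, neg_mem (one_mem _), one_mem _, zero_mem _⟩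
      · simp [Matrix.det_fin_two]
      · rw [isIntegralMatrix_iff]
        exact ⟨one_mem _, h2, zero_mem _, one_mem _⟩
      · simp [Matrix.det_fin_two]
      · ext i j
        fin_cases i <;> fin_cases j <;> simp [ht] <;> field_simp
        ring

/-- Elementary divisors: any two lattices have compatible bases, up to homothety. -/
theorem exists_common_basis (hϖ : Irreducible ϖ) (g h : GL (Fin 2) K) :
    ∃ (k : GL (Fin 2) K) (n : ℕ), DistLE ϖ g k 0 ∧
      DistLE ϖ (k * lowerGL 0 (algebraMap O K ϖ ^ n)
        (pow_ne_zero n (algebraMap_ne_zero_of_irreducible hϖ))) h 0 := by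
  obtain ⟨t, q, hq, h1⟩ := exists_distLE_lowerGL ϖ (g⁻¹ * h)
  obtain ⟨k, r, hr, hrO, h2, h3⟩ := exists_distLE_diagonal_lowerGL ϖ (t := t) hq
  obtain ⟨n, u, rfl⟩ := exists_eq_pow_mul_unit hϖ hr hrO
  have hp := pow_ne_zero n (algebraMap_ne_zero_of_irreducible (K := K) hϖ)
  -- The unit part of `r` is absorbed by a column operation.
  have h4 : DistLE ϖ (k * lowerGL 0 _ hp) (k * lowerGL 0 _ hr) 0 := by
    rw [distLE_mul_left_iff]
    refine distLE_zero_of_eq_smul_mul !![1, 0; 0, algebraMap O K u] ?_ ?_ ?_ one_ne_zero ?_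
    · rw [isIntegralMatrix_iff]
      exact ⟨one_mem _, zero_mem _, zero_mem _, ⟨u, rfl⟩⟩
    · simp [Matrix.det_fin_two]
    · simpa [Matrix.det_fin_two] using inv_algebraMap_unit_mem u
    · rw [coe_lowerGL, coe_lowerGL]
      ext i j
      fin_cases i <;> fin_cases j <;> simp
  refine ⟨g * k, n, ?_, ?_⟩
  · rw [← distLE_mul_left_iff g⁻¹, inv_mul_cancel, inv_mul_cancel_left]
    exact h2
  · rw [← distLE_mul_left_iff g⁻¹, mul_assoc, inv_mul_cancel_left]
    exact (h4.trans h3).trans h1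

/-- If `ϖ ^ n End(L) ⊆ End(L')`, the classes of `L` and `L'` have distance at most `n`. -/
theorem distLE_of_smul_mem (hϖ : Irreducible ϖ) {g h : GL (Fin 2) K} {n : ℕ}
    (H : ∀ X ∈ (latticeOf O g).endRing, algebraMap O K ϖ ^ n • X ∈ (latticeOf O h).endRing) :
    DistLE ϖ g h n := by
  have h0 := algebraMap_ne_zero_of_irreducible (K := K) hϖ
  obtain ⟨k, m, h1, h2⟩ := exists_common_basis hϖ g h
  have h3 : m ≤ n := by
    -- The elementary matrix sending the first common basis vector to the second stabilises the
    -- first lattice; in the basis of the second its entry is `ϖ ^ (-m)`, so `ϖ ^ n` can clear it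
    -- only if `m ≤ n`.
    have h4 : (k : Matrix (Fin 2) (Fin 2) K) * !![0, 0; 1, 0] *
        (↑k⁻¹ : Matrix (Fin 2) (Fin 2) K) ∈ (latticeOf O g).endRing := by
      rw [h1.endRing_eq h0, conj_mem_endRing_iff, isIntegralMatrix_iff]
      exact ⟨zero_mem _, zero_mem _, one_mem _, zero_mem _⟩
    have h5 := H _ h4
    rw [← h2.endRing_eq h0, ← smul_mul_assoc, ← mul_smul_comm, conj_mem_endRing_mul_iff,
      mem_endRing_lowerGL_iff] at h5
    have h6 := h5.2.2.1
    refine le_of_pow_div_pow_mem (K := K) hϖ ?_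
    simpa using h6
  have h4 := (h1.trans (distLE_lowerGL_pow hϖ k m)).trans h2
  exact h4.mono (by omega)

end

/-! ### Orders, primitive idempotents, and bounds on a third lattice -/

section

variable {O : Type*} [CommRing O] {K : Type*} [Field K] [Algebra O K]

theorem smul_mem_of_mem_range {Λ : Subalgebra O (Matrix (Fin 2) (Fin 2) K)} {x : K}
    (hx : x ∈ (algebraMap O K).range) {X : Matrix (Fin 2) (Fin 2) K} (hX : X ∈ Λ) :
    x • X ∈ Λ := by
  obtain ⟨a, rfl⟩ := hx
  rw [algebraMap_smul]
  exact Λ.smul_mem hX a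

theorem eq_sum_smul_conj_single (g : GL (Fin 2) K) (X : Matrix (Fin 2) (Fin 2) K) :
    X = ∑ i, ∑ j, ((↑g⁻¹ : Matrix (Fin 2) (Fin 2) K) * X * (g : Matrix (Fin 2) (Fin 2) K)) i j •
      ((g : Matrix (Fin 2) (Fin 2) K) * Matrix.single i j 1 *
        (↑g⁻¹ : Matrix (Fin 2) (Fin 2) K)) := by
  set Y := (↑g⁻¹ : Matrix (Fin 2) (Fin 2) K) * X * (g : Matrix (Fin 2) (Fin 2) K) with hY
  have h1 : X = (g : Matrix (Fin 2) (Fin 2) K) * Y * (↑g⁻¹ : Matrix (Fin 2) (Fin 2) K) := by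
    rw [hY]
    simp only [Matrix.mul_assoc]
    rw [Units.mul_inv, Matrix.mul_one, Units.mul_inv_cancel_left]
  conv_lhs => rw [h1, Matrix.matrix_eq_sum_single Y]
  simp only [Matrix.mul_sum, Matrix.sum_mul]
  refine Finset.sum_congr rfl fun i _ => Finset.sum_congr rfl fun j _ => ?_
  rw [← smul_mul_assoc, ← mul_smul_comm, Matrix.smul_single, smul_eq_mul, mul_one]

theorem isOrder_endRing_latticeOf (g : GL (Fin 2) K) : IsOrder (latticeOf O g).endRing := by
  let G : Fin 2 × Fin 2 → Matrix (Fin 2) (Fin 2) K := fun ij =>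
    (g : Matrix (Fin 2) (Fin 2) K) * Matrix.single ij.1 ij.2 1 *
      (↑g⁻¹ : Matrix (Fin 2) (Fin 2) K)
  have h : Subalgebra.toSubmodule (latticeOf O g).endRing = Submodule.span O (Set.range G) := by
    refine le_antisymm ?_ ?_
    · intro X hX
      rw [Subalgebra.mem_toSubmodule, mem_endRing_latticeOf] at hX
      rw [eq_sum_smul_conj_single g X]
      refine sum_mem fun i _ => sum_mem fun j _ => ?_
      obtain ⟨a, ha⟩ := hX i j
      rw [← ha, algebraMap_smul]
      exact Submodule.smul_mem _ _ (Submodule.subset_span ⟨(i, j), rfl⟩)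
    · rw [Submodule.span_le]
      rintro _ ⟨⟨i, j⟩, rfl⟩
      exact (conj_mem_endRing_iff g _).2 (isIntegralMatrix_single i j)
  refine ⟨?_, ?_⟩
  · rw [h]
    exact Submodule.fg_span (Set.finite_range G)
  · rw [h, Submodule.span_span_of_tower, eq_top_iff]
    intro X _
    rw [eq_sum_smul_conj_single g X]
    exact sum_mem fun i _ => sum_mem fun j _ =>
      Submodule.smul_mem _ _ (Submodule.subset_span ⟨(i, j), rfl⟩)

theorem mem_endRing_lowerGL_zero_iff {q : K} (hq : q ≠ 0) (Y : Matrix (Fin 2) (Fin 2) K) :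
    Y ∈ (latticeOf O (lowerGL 0 q hq)).endRing ↔
      Y 0 0 ∈ (algebraMap O K).range ∧ Y 0 1 * q ∈ (algebraMap O K).range ∧
      Y 1 0 / q ∈ (algebraMap O K).range ∧ Y 1 1 ∈ (algebraMap O K).range := by
  rw [mem_endRing_lowerGL_iff]
  simp only [mul_zero, add_zero, sub_zero, ne_eq, OfNat.ofNat_ne_zero, not_false_eq_true, zero_pow]

/-- The corner `e M₂(K) e` is the line `K e`, and a summand `f = e f e` lies in it. An idempotent `a
• e` forces `a` to be 0 or 1. -/
theorem isPrimitiveIdempotent_of_forall_smul {e : Matrix (Fin 2) (Fin 2) K}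
    (he : IsIdempotentElem e) (he0 : e ≠ 0) (h : ∀ X, ∃ a : K, e * X * e = a • e) :
    IsPrimitiveIdempotent e := by
  refine ⟨he, he0, fun f g hf hg hfg hgf hefg => ?_⟩
  have h1 : e * f * e = f := by
    rw [hefg, add_mul, hgf, hf.eq, add_zero, mul_add, hf.eq, hfg, add_zero]
  obtain ⟨a, ha⟩ := h f
  rw [h1] at ha
  have h2 : (a * a - a) • e = 0 := by
    have h3 := hf.eq
    rw [ha, smul_mul_smul_comm, he.eq] at h3
    rw [sub_smul, h3, sub_self]
  rcases smul_eq_zero.1 h2 with h3 | h3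
  · have h4 : a * (a - 1) = 0 := by
      rw [← h3]
      ring
    rcases mul_eq_zero.1 h4 with h5 | h5
    · left
      rw [ha, h5, zero_smul]
    · right
      rw [sub_eq_zero.1 h5, one_smul] at ha
      rw [← ha] at hefg
      simpa using hefg
  · exact absurd h3 he0

theorem isPrimitiveIdempotent_conj_single (k : GL (Fin 2) K) (i : Fin 2) :
    IsPrimitiveIdempotent ((k : Matrix (Fin 2) (Fin 2) K) * Matrix.single i i 1 *
      (↑k⁻¹ : Matrix (Fin 2) (Fin 2) K)) := by
  refine isPrimitiveIdempotent_of_forall_smul ?_ ?_ fun X => ?_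
  · rw [IsIdempotentElem]
    simp only [Matrix.mul_assoc]
    rw [Units.inv_mul_cancel_left, ← Matrix.mul_assoc (Matrix.single i i 1),
      Matrix.single_mul_single_same, mul_one]
  · intro h
    rw [Units.mul_left_eq_zero, Units.mul_right_eq_zero] at h
    have := congrFun (congrFun h i) i
    simp at this
  · refine ⟨((↑k⁻¹ : Matrix (Fin 2) (Fin 2) K) * X * (k : Matrix (Fin 2) (Fin 2) K)) i i, ?_⟩
    have h : Matrix.single i i (1 : K) *
        ((↑k⁻¹ : Matrix (Fin 2) (Fin 2) K) * X * (k : Matrix (Fin 2) (Fin 2) K)) *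
        Matrix.single i i 1 =
        ((↑k⁻¹ : Matrix (Fin 2) (Fin 2) K) * X * (k : Matrix (Fin 2) (Fin 2) K)) i i •
          Matrix.single i i 1 := by
      rw [Matrix.single_mul_mul_single]
      simp [Matrix.smul_single]
    rw [← smul_mul_assoc, ← mul_smul_comm, ← h]
    simp only [Matrix.mul_assoc]

/-- Each bound is a product of two entries in which the homothety scalar `c` or `d` cancels. The
bounds are what reduces a third lattice to one condition on the matrices stabilising the two
extremal ones. -/
theorem lowerGL_bounds {ϖ : O} {P t q : K} (hP : P ≠ 0) (hq : q ≠ 0)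
    {D : ℕ} (hPD : algebraMap O K ϖ ^ D = P)
    (h1 : DistLE ϖ 1 (lowerGL t q hq) D) (h2 : DistLE ϖ (lowerGL 0 P hP) (lowerGL t q hq) D) :
    q ∈ (algebraMap O K).range ∧ t ∈ (algebraMap O K).range ∧ P / q ∈ (algebraMap O K).range ∧
      t ^ 2 / q ∈ (algebraMap O K).range := by
  obtain ⟨c, hc, h3, h4⟩ := h1
  obtain ⟨d, hd, h5, h6⟩ := h2
  rw [hPD] at h4 h6
  rw [inv_one, one_mul, coe_lowerGL] at h3
  rw [mul_one, coe_inv_lowerGL] at h4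
  rw [Units.val_mul, coe_lowerGL, coe_inv_lowerGL] at h5 h6
  have e1 : c ∈ (algebraMap O K).range := by simpa using h3 0 0
  have e2 : P * c⁻¹ * q⁻¹ ∈ (algebraMap O K).range := by simpa using h4 1 1
  have e3 : d * (P⁻¹ * t) ∈ (algebraMap O K).range := by simpa using h5 1 0
  have e4 : d * (P⁻¹ * q) ∈ (algebraMap O K).range := by simpa using h5 1 1
  have e5 : P * d⁻¹ ∈ (algebraMap O K).range := by simpa using h6 0 0
  have e6 : P * d⁻¹ * (t / q) ∈ (algebraMap O K).range := by simpa using h6 1 0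
  refine ⟨?_, ?_, ?_, ?_⟩
  · convert mul_mem e4 e5 using 1
    field_simp
  · convert mul_mem e3 e5 using 1
    field_simp
  · convert mul_mem e1 e2 using 1
    field_simp
  · convert mul_mem e3 e6 using 1
    field_simp

end

/-! ### Maximal orders, and intersections of three or two endomorphism rings -/

section

variable {O : Type*} [CommRing O] [IsDomain O] [IsDiscreteValuationRing O]
  {K : Type*} [Field K] [Algebra O K] [IsFractionRing O K] {ϖ : O}
  {Λ : Subalgebra O (Matrix (Fin 2) (Fin 2) K)}

theorem exists_pow_mul_mem_range (hϖ : Irreducible ϖ) (x : K) :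
    ∃ n : ℕ, algebraMap O K ϖ ^ n * x ∈ (algebraMap O K).range := by
  by_cases hx : x = 0
  · exact ⟨0, by rw [hx, mul_zero]; exact zero_mem _⟩
  rcases mem_range_or_inv_mem_range (O := O) x with h | h
  · exact ⟨0, by rwa [pow_zero, one_mul]⟩
  · obtain ⟨n, u, hu⟩ := exists_eq_pow_mul_unit hϖ (inv_ne_zero hx) h
    refine ⟨n, ?_⟩
    have h1 : algebraMap O K ϖ ^ n * x = (algebraMap O K u)⁻¹ := by
      refine eq_inv_of_mul_eq_one_left ?_
      rw [mul_right_comm, ← hu, inv_mul_cancel₀ hx]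
    rw [h1]
    exact inv_algebraMap_unit_mem u

theorem IsOrder.exists_pow_smul_mem (hϖ : Irreducible ϖ) (hΛ : IsOrder Λ)
    (X : Matrix (Fin 2) (Fin 2) K) : ∃ n : ℕ, algebraMap O K ϖ ^ n • X ∈ Λ := by
  have hp : ∀ n : ℕ, algebraMap O K ϖ ^ n ∈ (algebraMap O K).range := fun n =>
    pow_mem (RingHom.mem_range_self _ ϖ) n
  have hX : X ∈ Submodule.span K (Subalgebra.toSubmodule Λ : Set (Matrix (Fin 2) (Fin 2) K)) := by
    rw [hΛ.span_eq_top]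
    exact Submodule.mem_top
  induction hX using Submodule.span_induction with
  | mem X hX => exact ⟨0, by rwa [pow_zero, one_smul]⟩
  | zero => exact ⟨0, by rw [smul_zero]; exact zero_mem _⟩
  | add X Y _ _ h1 h2 =>
    obtain ⟨m, hm⟩ := h1
    obtain ⟨n, hn⟩ := h2
    refine ⟨m + n, ?_⟩
    rw [smul_add]
    refine add_mem ?_ ?_
    · rw [pow_add, mul_comm, mul_smul]
      exact smul_mem_of_mem_range (hp n) hm
    · rw [pow_add, mul_smul]
      exact smul_mem_of_mem_range (hp m) hn
  | smul a X _ h =>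
    obtain ⟨m, hm⟩ := h
    obtain ⟨n, hn⟩ := exists_pow_mul_mem_range hϖ a
    refine ⟨n + m, ?_⟩
    rw [smul_smul, pow_add, mul_right_comm, mul_smul]
    exact smul_mem_of_mem_range hn hm

/-- This uniform exponent bounds the distance of every stable class from the standard vertex. It
only has to dominate the exponents of the four matrix units, so their sum is taken. -/
theorem IsOrder.exists_forall_pow_smul_mem (hϖ : Irreducible ϖ) (hΛ : IsOrder Λ) :
    ∃ n : ℕ, ∀ X, IsIntegralMatrix O X → algebraMap O K ϖ ^ n • X ∈ Λ := by
  choose f hf using fun ij : Fin 2 × Fin 2 =>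
    hΛ.exists_pow_smul_mem hϖ (Matrix.single ij.1 ij.2 (1 : K))
  refine ⟨∑ ij, f ij, fun X hX => ?_⟩
  rw [Matrix.matrix_eq_sum_single X, Finset.smul_sum]
  refine sum_mem fun i _ => ?_
  rw [Finset.smul_sum]
  refine sum_mem fun j _ => ?_
  have hle : f (i, j) ≤ ∑ ij, f ij :=
    Finset.single_le_sum (f := f) (fun _ _ => Nat.zero_le _) (Finset.mem_univ (i, j))
  have h1 : algebraMap O K ϖ ^ (∑ ij, f ij) • Matrix.single i j (X i j) =
      (algebraMap O K ϖ ^ (∑ ij, f ij - f (i, j)) * X i j) •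
        algebraMap O K ϖ ^ f (i, j) • Matrix.single i j (1 : K) := by
    rw [smul_smul, mul_right_comm, ← pow_add, Nat.sub_add_cancel hle, mul_smul, Matrix.smul_single,
      Matrix.smul_single, Matrix.smul_single]
    simp
  rw [h1]
  exact smul_mem_of_mem_range (mul_mem (pow_mem (RingHom.mem_range_self _ ϖ) _) (hX i j)) (hf (i, j))

theorem IsOrder.exists_le_endRing (hΛ : IsOrder Λ) :
    ∃ g : GL (Fin 2) K, Λ ≤ (latticeOf O g).endRing := by
  obtain ⟨L, hL⟩ := hΛ.exists_isStable
  obtain ⟨g, rfl⟩ := exists_eq_latticeOf L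
  exact ⟨g, hL⟩

/-- Every order lies in some endomorphism ring, and an inclusion of one endomorphism ring in another
forces distance 0, hence equality. -/
theorem isMaximalOrder_iff :
    IsMaximalOrder Λ ↔ ∃ g : GL (Fin 2) K, Λ = (latticeOf O g).endRing := by
  obtain ⟨ϖ, hϖ⟩ := IsDiscreteValuationRing.exists_irreducible O
  constructor
  · intro h
    obtain ⟨g, hg⟩ := h.prop.exists_le_endRing
    exact ⟨g, le_antisymm hg (h.2 (isOrder_endRing_latticeOf g) hg)⟩
  · rintro ⟨g, rfl⟩
    refine ⟨isOrder_endRing_latticeOf g, fun Λ' hΛ' hle => ?_⟩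
    obtain ⟨h, hh⟩ := hΛ'.exists_le_endRing
    have h1 : DistLE ϖ g h 0 := distLE_of_smul_mem hϖ fun X hX => by
      rw [pow_zero, one_smul]
      exact hh (hle hX)
    exact hh.trans (h1.endRing_eq (algebraMap_ne_zero_of_irreducible hϖ)).ge

theorem IsClosedOrder.mem_iff (hΛ : IsClosedOrder Λ) {X : Matrix (Fin 2) (Fin 2) K} :
    X ∈ Λ ↔ ∀ g : GL (Fin 2) K, Λ ≤ (latticeOf O g).endRing → X ∈ (latticeOf O g).endRing := by
  constructor
  · exact fun hX g hg => hg hX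
  · intro h
    rw [hΛ.2, mem_PZ]
    intro x hx
    rw [mem_invariantClasses] at hx
    obtain ⟨g, hg⟩ := x.exists_endRing_eq
    rw [hg] at hx ⊢
    exact h g hx

/-- Among divisibility conditions of bounded strength, one implies all the others. -/
theorem exists_strictest_denominator {ι : Type*} [Nonempty ι] (hϖ : Irreducible ϖ) {N : ℕ}
    (τ : ι → K) (hτ : ∀ i, algebraMap O K ϖ ^ N * τ i ∈ (algebraMap O K).range) :
    ∃ i, ∀ x ∈ (algebraMap O K).range, x * τ i ∈ (algebraMap O K).range →
      ∀ j, x * τ j ∈ (algebraMap O K).range := by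
  classical
  have hp : ∀ n : ℕ, algebraMap O K ϖ ^ n ∈ (algebraMap O K).range := fun n =>
    pow_mem (RingHom.mem_range_self _ ϖ) n
  have hex : ∃ s : ℕ, ∀ i, algebraMap O K ϖ ^ s * τ i ∈ (algebraMap O K).range := ⟨N, hτ⟩
  -- The least exponent clearing all the `τ j` is already required by one `τ i`; if it is 0, any
  -- index will do.
  obtain ⟨i, hi⟩ : ∃ i, ∀ s < Nat.find hex,
      algebraMap O K ϖ ^ s * τ i ∉ (algebraMap O K).range := by
    by_cases h0 : Nat.find hex = 0
    · exact ⟨Classical.arbitrary ι, fun s hs => by omega⟩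
    · have h1 := Nat.find_min hex (Nat.sub_one_lt h0)
      push Not at h1
      obtain ⟨i, hi⟩ := h1
      refine ⟨i, fun s hs hmem => hi ?_⟩
      rw [show Nat.find hex - 1 = (Nat.find hex - 1 - s) + s by omega, pow_add, mul_assoc]
      exact mul_mem (hp _) hmem
  refine ⟨i, fun x hx hxi j => ?_⟩
  by_cases hx0 : x = 0
  · rw [hx0, zero_mul]
    exact zero_mem _
  obtain ⟨e, u, rfl⟩ := exists_eq_pow_mul_unit hϖ hx0 hx
  have he : Nat.find hex ≤ e := by
    by_contra hlt
    refine hi e (not_le.1 hlt) ?_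
    have h1 := mul_mem (inv_algebraMap_unit_mem (K := K) u) hxi
    convert h1 using 1
    field_simp [algebraMap_unit_ne_zero (K := K) u]
  have h1 := mul_mem (mul_mem (hp (e - Nat.find hex)) (RingHom.mem_range_self (algebraMap O K) u))
    (Nat.find_spec hex j)
  convert h1 using 1
  rw [← Nat.sub_add_cancel he, pow_add, Nat.add_sub_cancel]
  ring

/-- The intersection of the endomorphism rings of a bounded set of lattices is the intersection of
the endomorphism rings of three of them. -/
theorem exists_three_of_bounded (hϖ : Irreducible ϖ) {S : Set (GL (Fin 2) K)} (hS : S.Nonempty)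
    {N : ℕ} (hN : ∀ g ∈ S, ∀ h ∈ S, DistLE ϖ g h N) :
    ∃ g₁ ∈ S, ∃ g₂ ∈ S, ∃ g₃ ∈ S, ∀ X, X ∈ (latticeOf O g₁).endRing →
      X ∈ (latticeOf O g₂).endRing → X ∈ (latticeOf O g₃).endRing →
      ∀ g ∈ S, X ∈ (latticeOf O g).endRing := by
  have h0 := algebraMap_ne_zero_of_irreducible (K := K) hϖ
  -- The distances realised between members of `S`; the maximum `D` is attained by `g₁` and `g₂`.
  let T : Set ℕ := {n | ∃ g ∈ S, ∃ h ∈ S, ∃ k, DistLE ϖ g k 0 ∧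
    DistLE ϖ (k * lowerGL 0 (algebraMap O K ϖ ^ n) (pow_ne_zero n h0)) h 0}
  have hTN : ∀ n ∈ T, n ≤ N := by
    rintro n ⟨g, hg, h, hh, k, h1, h2⟩
    have h3 := ((h1.symm h0).trans (hN g hg h hh)).trans (h2.symm h0)
    rw [zero_add, add_zero] at h3
    exact le_of_distLE_lowerGL_pow hϖ h3
  have hTb : BddAbove T := ⟨N, hTN⟩
  have hTne : T.Nonempty := by
    obtain ⟨g, hg⟩ := hS
    obtain ⟨k, n, h1, h2⟩ := exists_common_basis hϖ g g
    exact ⟨n, g, hg, g, hg, k, h1, h2⟩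
  obtain ⟨g₁, hg₁, g₂, hg₂, k, hk₁, hk₂⟩ := Nat.sSup_mem hTne hTb
  set D := sSup T with hD
  have hdist : ∀ g ∈ S, ∀ h ∈ S, DistLE ϖ g h D := by
    intro g hg h hh
    obtain ⟨k, n, h1, h2⟩ := exists_common_basis hϖ g h
    have h3 := (h1.trans (distLE_lowerGL_pow hϖ k n)).trans h2
    rw [zero_add, add_zero] at h3
    exact h3.mono (le_csSup hTb ⟨g, hg, h, hh, k, h1, h2⟩)
  set P := algebraMap O K ϖ ^ D with hP
  have hP0 : P ≠ 0 := pow_ne_zero D h0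
  -- Hermite form of every member of `S` in the basis `k` adapted to the extremal pair.
  choose t q hq hw using fun w : S => exists_distLE_lowerGL ϖ (k⁻¹ * w.1)
  have hw' : ∀ w : S, DistLE ϖ (k * lowerGL (t w) (q w) (hq w)) w.1 0 := fun w => by
    rw [← distLE_mul_left_iff k⁻¹, inv_mul_cancel_left]
    exact hw w
  have hbd := fun w : S => lowerGL_bounds (ϖ := ϖ) (t := t w) (D := D) hP0 (hq w) hP.symm (by
      have h1 := ((hk₁.symm h0).trans (hdist g₁ hg₁ w.1 w.2)).trans ((hw' w).symm h0)
      rw [zero_add, add_zero, ← distLE_mul_left_iff k⁻¹, inv_mul_cancel,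
        inv_mul_cancel_left] at h1
      exact h1) (by
      have h1 := (hk₂.trans (hdist g₂ hg₂ w.1 w.2)).trans ((hw' w).symm h0)
      rw [zero_add, add_zero, distLE_mul_left_iff] at h1
      exact h1)
  have hSne : Nonempty S := hS.to_subtype
  obtain ⟨w₀, hw₀⟩ := exists_strictest_denominator (N := D) hϖ (fun w : S => t w / q w) fun w => by
    convert mul_mem (hbd w).2.2.1 (hbd w).2.1 using 1
    ring
  refine ⟨g₁, hg₁, g₂, hg₂, w₀.1, w₀.2, fun X hX₁ hX₂ hX₀ g hg => ?_⟩
  obtain ⟨Y, rfl⟩ : ∃ Y, X = (k : Matrix (Fin 2) (Fin 2) K) * Y *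
      (↑k⁻¹ : Matrix (Fin 2) (Fin 2) K) := by
    refine ⟨(↑k⁻¹ : Matrix (Fin 2) (Fin 2) K) * X * (k : Matrix (Fin 2) (Fin 2) K), ?_⟩
    simp only [Matrix.mul_assoc]
    rw [Units.mul_inv, Matrix.mul_one, Units.mul_inv_cancel_left]
  rw [hk₁.endRing_eq h0, conj_mem_endRing_iff] at hX₁
  rw [← hk₂.endRing_eq h0, conj_mem_endRing_mul_iff, mem_endRing_lowerGL_zero_iff] at hX₂
  -- For a `Y` stabilising the extremal pair, the bounds make every other term of the membership
  -- criterion integral.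
  have hiff : ∀ w : S, (k : Matrix (Fin 2) (Fin 2) K) * Y * (↑k⁻¹ : Matrix (Fin 2) (Fin 2) K) ∈
      (latticeOf O w.1).endRing ↔ (Y 1 1 - Y 0 0) * (t w / q w) ∈ (algebraMap O K).range := by
    intro w
    obtain ⟨b1, b2, b3, b4⟩ := hbd w
    rw [← (hw' w).endRing_eq h0, conj_mem_endRing_mul_iff, mem_endRing_lowerGL_iff]
    have h1 : Y 1 0 / q w - Y 0 1 * (t w ^ 2 / q w) ∈ (algebraMap O K).range := by
      refine sub_mem ?_ (mul_mem (hX₁ 0 1) b4)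
      convert mul_mem hX₂.2.2.1 b3 using 1
      rw [div_mul_div_cancel₀ hP0]
    have h2 : (Y 1 0 + (Y 1 1 - Y 0 0) * t w - Y 0 1 * t w ^ 2) / q w =
        (Y 1 0 / q w - Y 0 1 * (t w ^ 2 / q w)) + (Y 1 1 - Y 0 0) * (t w / q w) := by
      ring
    rw [h2, add_mem_cancel_left h1]
    exact ⟨fun h => h.2.2.1, fun h => ⟨add_mem (hX₁ 0 0) (mul_mem (hX₁ 0 1) b2),
      mul_mem (hX₁ 0 1) b1, h, sub_mem (hX₁ 1 1) (mul_mem (hX₁ 0 1) b2)⟩⟩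
  rw [hiff w₀] at hX₀
  exact (hiff ⟨g, hg⟩).2 (hw₀ _ (sub_mem (hX₁ 1 1) (hX₁ 0 0)) hX₀ ⟨g, hg⟩)

/-- All stable classes lie within `N` of the standard vertex, hence within `N + N` of one another,
so the bounded case applies. -/
theorem IsClosedOrder.exists_three (hΛ : IsClosedOrder Λ) :
    ∃ x y z : Vertex O K 2, Λ = PZ {x, y, z} := by
  obtain ⟨ϖ, hϖ⟩ := IsDiscreteValuationRing.exists_irreducible O
  have h0 := algebraMap_ne_zero_of_irreducible (K := K) hϖ
  obtain ⟨N, hN⟩ := hΛ.1.exists_forall_pow_smul_mem hϖ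
  let S : Set (GL (Fin 2) K) := {g | Λ ≤ (latticeOf O g).endRing}
  have hS1 : ∀ g ∈ S, DistLE ϖ 1 g N := fun g hg => distLE_of_smul_mem hϖ fun X hX =>
    hg (hN X (mem_endRing_one_iff X |>.1 hX))
  obtain ⟨g₁, hg₁, g₂, hg₂, g₃, hg₃, h⟩ := exists_three_of_bounded hϖ (S := S) (N := N + N)
    hΛ.1.exists_le_endRing fun g hg h hh => ((hS1 g hg).symm h0).trans (hS1 h hh)
  refine ⟨(latticeOf O g₁).toVertex, (latticeOf O g₂).toVertex, (latticeOf O g₃).toVertex, ?_⟩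
  ext X
  rw [mem_PZ]
  constructor
  · rintro hX x (rfl | rfl | rfl)
    · exact hg₁ hX
    · exact hg₂ hX
    · exact hg₃ hX
  · intro hX
    rw [hΛ.mem_iff]
    exact h X (hX (latticeOf O g₁).toVertex (by simp)) (hX (latticeOf O g₂).toVertex (by simp))
      (hX (latticeOf O g₃).toVertex (by simp))

/-- The projections onto the lines of a common basis stabilise both lattices. The classes `x` and
`y` may coincide. -/
theorem isGraduatedOrder_of_eq_PZ_pair (hΛ : IsOrder Λ) {x y : Vertex O K 2}
    (h : Λ = PZ {x, y}) : IsGraduatedOrder Λ := by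
  obtain ⟨ϖ, hϖ⟩ := IsDiscreteValuationRing.exists_irreducible O
  have h0 := algebraMap_ne_zero_of_irreducible (K := K) hϖ
  obtain ⟨g₁, hg₁⟩ := x.exists_endRing_eq
  obtain ⟨g₂, hg₂⟩ := y.exists_endRing_eq
  obtain ⟨k, n, hk₁, hk₂⟩ := exists_common_basis hϖ g₁ g₂
  have hoff : ∀ i a b : Fin 2, a ≠ b → (Matrix.single i i (1 : K)) a b = 0 := by
    intro i a b hab
    rw [Matrix.single_apply, if_neg]
    rintro ⟨rfl, rfl⟩
    exact hab rfl
  refine ⟨hΛ, fun i => (k : Matrix (Fin 2) (Fin 2) K) * Matrix.single i i 1 *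
    (↑k⁻¹ : Matrix (Fin 2) (Fin 2) K), ⟨⟨fun i => (isPrimitiveIdempotent_conj_single k i).1, ?_⟩,
    ?_⟩, isPrimitiveIdempotent_conj_single k, fun i => ?_⟩
  · intro i j hij
    simp only [Matrix.mul_assoc]
    rw [Units.inv_mul_cancel_left, ← Matrix.mul_assoc (Matrix.single i i 1),
      Matrix.single_mul_single_of_ne _ _ _ _ hij, Matrix.zero_mul, Matrix.mul_zero]
  · rw [← Finset.sum_mul, ← Finset.mul_sum]
    have h1 : ∑ i : Fin 2, Matrix.single i i (1 : K) = 1 := by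
      ext a b
      fin_cases a <;> fin_cases b <;> simp [Fin.sum_univ_two]
    rw [h1, Matrix.mul_one, Units.mul_inv]
  · rw [h, mem_PZ]
    rintro v (rfl | rfl)
    · rw [hg₁, hk₁.endRing_eq h0, conj_mem_endRing_iff]
      exact isIntegralMatrix_single i i
    · rw [hg₂, ← hk₂.endRing_eq h0, conj_mem_endRing_mul_iff, mem_endRing_lowerGL_zero_iff,
        hoff i 0 1 (by decide), hoff i 1 0 (by decide), zero_mul, zero_div]
      exact ⟨isIntegralMatrix_single i i 0 0, zero_mem _, zero_mem _, isIntegralMatrix_single i i 1 1⟩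

end

/-! ### Simultaneous diagonalisation of idempotents -/

section

variable {O : Type*} [CommRing O] {K : Type*} [Field K] [Algebra O K]

/-- Two orthogonal nonzero idempotents with sum `1` are simultaneously diagonalisable. -/
theorem exists_conj_single_eq {e f : Matrix (Fin 2) (Fin 2) K} (he : IsIdempotentElem e)
    (hf : IsIdempotentElem f) (hef : e * f = 0) (hfe : f * e = 0) (he0 : e ≠ 0) (hf0 : f ≠ 0)
    (hsum : e + f = 1) :
    ∃ k : GL (Fin 2) K, e = (k : Matrix (Fin 2) (Fin 2) K) * Matrix.single 0 0 1 *
        (↑k⁻¹ : Matrix (Fin 2) (Fin 2) K) ∧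
      f = (k : Matrix (Fin 2) (Fin 2) K) * Matrix.single 1 1 1 *
        (↑k⁻¹ : Matrix (Fin 2) (Fin 2) K) := by
  have hex : ∀ X : Matrix (Fin 2) (Fin 2) K, X ≠ 0 → ∃ v, X.mulVec v ≠ 0 := by
    intro X hX
    by_contra! h
    refine hX (Matrix.ext_of_mulVec_single fun i => ?_)
    rw [h, Matrix.zero_mulVec]
  obtain ⟨v, hv⟩ := hex e he0
  obtain ⟨w, hw⟩ := hex f hf0
  -- One nonzero vector from the image of each idempotent; these are eigenvectors, independent by
  -- orthogonality.
  let M : Matrix (Fin 2) (Fin 2) K := Matrix.of fun i j => ![e.mulVec v, f.mulVec w] j i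
  have hee : e.mulVec (e.mulVec v) = e.mulVec v := by rw [Matrix.mulVec_mulVec, he.eq]
  have hef' : e.mulVec (f.mulVec w) = 0 := by rw [Matrix.mulVec_mulVec, hef, Matrix.zero_mulVec]
  have hfe' : f.mulVec (e.mulVec v) = 0 := by rw [Matrix.mulVec_mulVec, hfe, Matrix.zero_mulVec]
  have hff : f.mulVec (f.mulVec w) = f.mulVec w := by rw [Matrix.mulVec_mulVec, hf.eq]
  have hM : IsUnit M := by
    rw [← Matrix.linearIndependent_cols_iff_isUnit]
    have h1 : M.col = ![e.mulVec v, f.mulVec w] := rfl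
    rw [h1, LinearIndependent.pair_iff]
    intro a b hab
    have h2 := congrArg e.mulVec hab
    have h3 := congrArg f.mulVec hab
    rw [Matrix.mulVec_add, Matrix.mulVec_smul, Matrix.mulVec_smul, hee, hef', smul_zero, add_zero,
      Matrix.mulVec_zero, smul_eq_zero] at h2
    rw [Matrix.mulVec_add, Matrix.mulVec_smul, Matrix.mulVec_smul, hfe', hff, smul_zero, zero_add,
      Matrix.mulVec_zero, smul_eq_zero] at h3
    exact ⟨h2.resolve_right hv, h3.resolve_right hw⟩
  have hk : e * M = M * Matrix.single 0 0 1 := by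
    ext i j
    fin_cases j
    · change e.mulVec (e.mulVec v) i = (M * Matrix.single 0 0 1 : Matrix (Fin 2) (Fin 2) K) i 0
      have h1 : (M * Matrix.single 0 0 1 : Matrix (Fin 2) (Fin 2) K) i 0 = M i 0 := by simp
      rw [hee, h1]
      rfl
    · change e.mulVec (f.mulVec w) i = (M * Matrix.single 0 0 1 : Matrix (Fin 2) (Fin 2) K) i 1
      have h1 : (M * Matrix.single 0 0 1 : Matrix (Fin 2) (Fin 2) K) i 1 = 0 := by simp
      rw [hef', h1]
      rfl
  have h1 : e = (hM.unit : Matrix (Fin 2) (Fin 2) K) * Matrix.single 0 0 1 *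
      (↑hM.unit⁻¹ : Matrix (Fin 2) (Fin 2) K) := by
    rw [Units.eq_mul_inv_iff_mul_eq]
    exact hk
  refine ⟨hM.unit, h1, ?_⟩
  have h2 : Matrix.single 1 1 (1 : K) = (1 : Matrix (Fin 2) (Fin 2) K) - Matrix.single 0 0 1 := by
    ext i j
    fin_cases i <;> fin_cases j <;> simp
  rw [h2, mul_sub, sub_mul, ← h1, Matrix.mul_one, Units.mul_inv, ← hsum, add_sub_cancel_left]

end

/-! ### Graduated orders as intersections of two endomorphism rings -/

section

variable {O : Type*} [CommRing O] [IsDomain O] [IsDiscreteValuationRing O]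
  {K : Type*} [Field K] [Algebra O K] [IsFractionRing O K]
  {Λ : Subalgebra O (Matrix (Fin 2) (Fin 2) K)}

/-- A graduated order contains the diagonal idempotents with respect to a basis of some
stable lattice. -/
theorem IsGraduatedOrder.exists_adapted (hΛ : IsGraduatedOrder Λ) :
    ∃ k : GL (Fin 2) K, Λ ≤ (latticeOf O k).endRing ∧
      ∀ i, (k : Matrix (Fin 2) (Fin 2) K) * Matrix.single i i 1 *
        (↑k⁻¹ : Matrix (Fin 2) (Fin 2) K) ∈ Λ := by
  obtain ⟨ϖ, hϖ⟩ := IsDiscreteValuationRing.exists_irreducible O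
  have h0 := algebraMap_ne_zero_of_irreducible (K := K) hϖ
  obtain ⟨hord, ε, hε, hprim, hmem⟩ := hΛ
  obtain ⟨k, hk0, hk1⟩ := exists_conj_single_eq (hε.idem 0) (hε.idem 1)
    (hε.ortho (by decide)) (hε.ortho (by decide)) (hprim 0).2.1 (hprim 1).2.1
    (by rw [← hε.complete, Fin.sum_univ_two])
  obtain ⟨h, hh⟩ := hord.exists_le_endRing
  obtain ⟨t, q, hq, h1⟩ := exists_distLE_lowerGL ϖ (k⁻¹ * h)
  have h2 : DistLE ϖ (k * lowerGL t q hq) h 0 := by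
    rw [← distLE_mul_left_iff k⁻¹, inv_mul_cancel_left]
    exact h1
  rw [← h2.endRing_eq h0] at hh
  -- Stability under the first idempotent makes `t / q` integral, so a column operation removes `t`
  -- and the stable lattice becomes diagonal in the eigenbasis.
  have h3 := hh (hmem 0)
  rw [hk0, conj_mem_endRing_mul_iff, mem_endRing_lowerGL_iff] at h3
  have h4 : t / q ∈ (algebraMap O K).range := by
    have h5 := neg_mem h3.2.2.1
    simpa [neg_div] using h5
  have h5 : DistLE ϖ (k * lowerGL 0 q hq) (k * lowerGL t q hq) 0 := by
    rw [distLE_mul_left_iff]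
    refine distLE_zero_of_eq_smul_mul !![1, 0; t / q, 1] ?_ ?_ ?_ one_ne_zero ?_
    · rw [isIntegralMatrix_iff]
      exact ⟨one_mem _, zero_mem _, h4, one_mem _⟩
    · simp [Matrix.det_fin_two]
    · simp [Matrix.det_fin_two]
    · rw [coe_lowerGL, coe_lowerGL]
      ext i j
      fin_cases i <;> fin_cases j <;> simp
      field_simp
  rw [← h5.endRing_eq h0] at hh
  refine ⟨_, hh, fun i => ?_⟩
  -- Rescaling the eigenbasis by a diagonal matrix does not change the idempotents.
  have h6 : (lowerGL 0 q hq : Matrix (Fin 2) (Fin 2) K) * Matrix.single i i 1 *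
      (↑(lowerGL 0 q hq)⁻¹ : Matrix (Fin 2) (Fin 2) K) = Matrix.single i i 1 := by
    rw [Units.mul_inv_eq_iff_eq_mul, coe_lowerGL]
    ext a b
    fin_cases i <;> fin_cases a <;> fin_cases b <;> simp [Matrix.mul_apply, Matrix.single_apply]
  have h7 : ((k * lowerGL 0 q hq : GL (Fin 2) K) : Matrix (Fin 2) (Fin 2) K) *
      Matrix.single i i 1 * (↑(k * lowerGL 0 q hq)⁻¹ : Matrix (Fin 2) (Fin 2) K) =
      (k : Matrix (Fin 2) (Fin 2) K) * Matrix.single i i 1 *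
        (↑k⁻¹ : Matrix (Fin 2) (Fin 2) K) := by
    conv_rhs => rw [← h6]
    simp only [mul_inv_rev, Units.val_mul, Matrix.mul_assoc]
  rw [h7]
  fin_cases i
  · exact hk0 ▸ hmem 0
  · exact hk1 ▸ hmem 1

/-- The coefficients of a nonzero matrix `E` in an order form a principal fractional ideal; if they
are all integral, it is generated by a power of the uniformizer. -/
theorem IsOrder.exists_smul_mem_iff {ϖ : O} (hϖ : Irreducible ϖ) (hΛ : IsOrder Λ)
    (E : Matrix (Fin 2) (Fin 2) K) (hE : ∀ x : K, x • E ∈ Λ → x ∈ (algebraMap O K).range) :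
    ∃ n : ℕ, ∀ x : K, x • E ∈ Λ ↔ x / algebraMap O K ϖ ^ n ∈ (algebraMap O K).range := by
  let I : Ideal O :=
    { carrier := {a | algebraMap O K a • E ∈ Λ}
      add_mem' := fun {a b} ha hb => by
        change algebraMap O K (a + b) • E ∈ Λ
        rw [map_add, add_smul]
        exact add_mem ha hb
      zero_mem' := by
        change algebraMap O K 0 • E ∈ Λ
        rw [map_zero, zero_smul]
        exact zero_mem _
      smul_mem' := fun a b hb => by
        change algebraMap O K (a * b) • E ∈ Λ
        rw [map_mul, mul_smul]
        exact smul_mem_of_mem_range ⟨a, rfl⟩ hb }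
  -- `Λ` has full rank, so it contains some `ϖ ^ n • E`.
  have hI : I ≠ ⊥ := by
    obtain ⟨n, hn⟩ := hΛ.exists_pow_smul_mem hϖ E
    intro h
    have h1 : ϖ ^ n ∈ I := by
      change algebraMap O K (ϖ ^ n) • E ∈ Λ
      rwa [map_pow]
    rw [h, Ideal.mem_bot] at h1
    exact pow_ne_zero n hϖ.ne_zero h1
  obtain ⟨n, hn⟩ := IsDiscreteValuationRing.ideal_eq_span_pow_irreducible hI hϖ
  have hp := pow_ne_zero n (algebraMap_ne_zero_of_irreducible (K := K) hϖ)
  refine ⟨n, fun x => ⟨fun hx => ?_, ?_⟩⟩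
  · obtain ⟨a, rfl⟩ := hE x hx
    have h1 : a ∈ I := hx
    rw [hn, Ideal.mem_span_singleton] at h1
    obtain ⟨b, rfl⟩ := h1
    refine ⟨b, ?_⟩
    rw [map_mul, map_pow, mul_div_cancel_left₀ _ hp]
  · rintro ⟨b, hb⟩
    have h1 : ϖ ^ n * b ∈ I := by
      rw [hn]
      exact Ideal.mul_mem_right _ _ (Ideal.mem_span_singleton_self _)
    have h2 : x = algebraMap O K (ϖ ^ n * b) := by
      rw [map_mul, map_pow, hb, mul_div_cancel₀ _ hp]
    rw [h2]
    exact h1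

/-- With its diagonal idempotents in `Λ`, the order is the direct sum of its Peirce components. The
diagonal ones are `O`, and the others are ideals `ϖ ^ m O` and `ϖ ^ n O`. -/
theorem IsGraduatedOrder.exists_pair (hΛ : IsGraduatedOrder Λ) :
    ∃ x y : Vertex O K 2, Λ = PZ {x, y} := by
  obtain ⟨ϖ, hϖ⟩ := IsDiscreteValuationRing.exists_irreducible O
  have h0 := algebraMap_ne_zero_of_irreducible (K := K) hϖ
  obtain ⟨k, hle, hk⟩ := hΛ.exists_adapted
  let E : Fin 2 → Fin 2 → Matrix (Fin 2) (Fin 2) K := fun i j =>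
    (k : Matrix (Fin 2) (Fin 2) K) * Matrix.single i j 1 * (↑k⁻¹ : Matrix (Fin 2) (Fin 2) K)
  have hconj : ∀ X : Matrix (Fin 2) (Fin 2) K, ∃ Y, X = (k : Matrix (Fin 2) (Fin 2) K) * Y *
      (↑k⁻¹ : Matrix (Fin 2) (Fin 2) K) := by
    intro X
    refine ⟨(↑k⁻¹ : Matrix (Fin 2) (Fin 2) K) * X * (k : Matrix (Fin 2) (Fin 2) K), ?_⟩
    simp only [Matrix.mul_assoc]
    rw [Units.mul_inv, Matrix.mul_one, Units.mul_inv_cancel_left]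
  have hsmul : ∀ (i j : Fin 2) (x : K), x • E i j = (k : Matrix (Fin 2) (Fin 2) K) *
      Matrix.single i j x * (↑k⁻¹ : Matrix (Fin 2) (Fin 2) K) := by
    intro i j x
    rw [← smul_mul_assoc, ← mul_smul_comm, Matrix.smul_single, smul_eq_mul, mul_one]
  have hE : ∀ (i j : Fin 2) (x : K), x • E i j ∈ Λ → x ∈ (algebraMap O K).range := by
    intro i j x hx
    have h1 := hle hx
    rw [hsmul, conj_mem_endRing_iff] at h1
    simpa using h1 i j
  obtain ⟨m, hm⟩ := hΛ.1.exists_smul_mem_iff hϖ (E 0 1) (hE 0 1)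
  obtain ⟨n, hn⟩ := hΛ.1.exists_smul_mem_iff hϖ (E 1 0) (hE 1 0)
  have hpm := pow_ne_zero m h0
  have hpn := pow_ne_zero n h0
  have hmem : ∀ Y : Matrix (Fin 2) (Fin 2) K, (k : Matrix (Fin 2) (Fin 2) K) * Y *
      (↑k⁻¹ : Matrix (Fin 2) (Fin 2) K) ∈ Λ ↔ Y 0 0 ∈ (algebraMap O K).range ∧
        Y 0 1 • E 0 1 ∈ Λ ∧ Y 1 0 • E 1 0 ∈ Λ ∧ Y 1 1 ∈ (algebraMap O K).range := by
    intro Y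
    constructor
    · intro hY
      have h1 := (conj_mem_endRing_iff k Y).1 (hle hY)
      -- Multiplication by the idempotents `E i i` and `E j j` on either side isolates one entry.
      have h2 : ∀ i j, Y i j • E i j ∈ Λ := by
        intro i j
        have h3 := mul_mem (mul_mem (hk i) hY) (hk j)
        convert h3 using 1
        have h4 : Matrix.single i j (Y i j) =
            Matrix.single i i (1 : K) * Y * Matrix.single j j 1 := by
          rw [Matrix.single_mul_mul_single, one_mul, mul_one]
        rw [hsmul, h4]
        simp only [Matrix.mul_assoc]
        rw [Units.inv_mul_cancel_left, Units.inv_mul_cancel_left]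
      exact ⟨h1 0 0, h2 0 1, h2 1 0, h1 1 1⟩
    · rintro ⟨h1, h2, h3, h4⟩
      have h5 : (k : Matrix (Fin 2) (Fin 2) K) * Y * (↑k⁻¹ : Matrix (Fin 2) (Fin 2) K) =
          Y 0 0 • E 0 0 + Y 0 1 • E 0 1 + (Y 1 0 • E 1 0 + Y 1 1 • E 1 1) := by
        conv_lhs => rw [Matrix.matrix_eq_sum_single Y]
        simp only [Matrix.mul_add, Matrix.add_mul, Fin.sum_univ_two, hsmul]
      rw [h5]
      exact add_mem (add_mem (smul_mem_of_mem_range h1 (hk 0)) h2)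
        (add_mem h3 (smul_mem_of_mem_range h4 (hk 1)))
  have hs : ∀ s : ℕ, algebraMap O K ϖ ^ s ∈ (algebraMap O K).range := fun s =>
    pow_mem (RingHom.mem_range_self _ ϖ) s
  have hp : ∀ (s : ℕ) {x : K}, x / algebraMap O K ϖ ^ s ∈ (algebraMap O K).range →
      x ∈ (algebraMap O K).range := by
    intro s x hx
    have h1 := mul_mem hx (hs s)
    rwa [div_mul_cancel₀ _ (pow_ne_zero s h0)] at h1
  -- In the basis `k`, `diag(1, ϖ ^ (-m))` imposes `Y 0 1 ∈ ϖ ^ m O` and `diag(1, ϖ ^ n)` imposes `Y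
  -- 1 0 ∈ ϖ ^ n O`. The other off-diagonal condition of each then follows, since `m` and `n` are
  -- nonnegative.
  refine ⟨(latticeOf O (k * lowerGL 0 _ (inv_ne_zero hpm))).toVertex,
    (latticeOf O (k * lowerGL 0 _ hpn)).toVertex, ?_⟩
  ext X
  obtain ⟨Y, rfl⟩ := hconj X
  rw [mem_PZ, hmem, hm, hn]
  have hfst : (k : Matrix (Fin 2) (Fin 2) K) * Y * (↑k⁻¹ : Matrix (Fin 2) (Fin 2) K) ∈
      (latticeOf O (k * lowerGL 0 _ (inv_ne_zero hpm))).toVertex.endRing ↔ _ :=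
    (conj_mem_endRing_mul_iff k _ Y).trans (mem_endRing_lowerGL_zero_iff (inv_ne_zero hpm) Y)
  have hsnd : (k : Matrix (Fin 2) (Fin 2) K) * Y * (↑k⁻¹ : Matrix (Fin 2) (Fin 2) K) ∈
      (latticeOf O (k * lowerGL 0 _ hpn)).toVertex.endRing ↔ _ :=
    (conj_mem_endRing_mul_iff k _ Y).trans (mem_endRing_lowerGL_zero_iff hpn Y)
  rw [← div_eq_mul_inv, div_inv_eq_mul] at hfst
  constructor
  · rintro ⟨h1, h2, h3, h4⟩ x (rfl | rfl)
    · exact hfst.2 ⟨h1, h2, mul_mem (hp n h3) (hs m), h4⟩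
    · exact hsnd.2 ⟨h1, mul_mem (hp m h2) (hs n), h3, h4⟩
  · intro h
    obtain ⟨h1, h2, -, h4⟩ := hfst.1 (h _ (Or.inl rfl))
    obtain ⟨-, -, h3, -⟩ := hsnd.1 (h _ (Or.inr rfl))
    exact ⟨h1, h2, h3, h4⟩

end

/-! ### Computing the degree -/

section

variable {O : Type*} [CommRing O] {K : Type*} [Field K] [Algebra O K] {d : ℕ}
  {Λ : Subalgebra O (Matrix (Fin d) (Fin d) K)}

theorem encard_pair_le {α : Type*} (x y : α) : ({x, y} : Set α).encard ≤ 2 :=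
  (Set.encard_insert_le _ _).trans_eq (by rw [Set.encard_singleton, one_add_one_eq_two])

theorem degree_le_of_eq_PZ {𝓛 : Set (Vertex O K d)} (hne : 𝓛.Nonempty) (h : Λ = PZ 𝓛) {n : ℕ∞}
    (hn : 𝓛.encard ≤ n + 1) : degree Λ ≤ n :=
  le_trans (sInf_le ⟨𝓛, hne, h, rfl⟩) (tsub_le_iff_right.2 hn)

theorem exists_encard_of_degree_eq {n : ℕ} (h : degree Λ = n) :
    ∃ 𝓛 : Set (Vertex O K d), Λ = PZ 𝓛 ∧ 𝓛.encard = n + 1 := by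
  have hne : {n : ℕ∞ | ∃ 𝓛 : Set (Vertex O K d), 𝓛.Nonempty ∧ Λ = PZ 𝓛 ∧
      n = 𝓛.encard - 1}.Nonempty := by
    -- Over the empty set the infimum would be `⊤`, not the finite value `n`.
    by_contra hcon
    rw [Set.not_nonempty_iff_eq_empty] at hcon
    rw [degree, hcon, sInf_empty] at h
    exact ENat.top_ne_natCast n h
  obtain ⟨𝓛, hne', hΛ, hcard⟩ := csInf_mem hne
  refine ⟨𝓛, hΛ, ?_⟩
  -- The truncated subtraction can be undone only because `𝓛` is non-empty.
  rw [← h, degree, hcard, tsub_add_cancel_of_le]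
  exact Set.one_le_encard_iff_nonempty.2 hne'

end

/-! ### Classification by degree -/

section

variable {O : Type*} [CommRing O] [IsDomain O] [IsDiscreteValuationRing O]
  {K : Type*} [Field K] [Algebra O K] [IsFractionRing O K]
  {Λ : Subalgebra O (Matrix (Fin 2) (Fin 2) K)}

theorem IsClosedOrder.degree_le_two (hΛ : IsClosedOrder Λ) : degree Λ ≤ 2 := by
  obtain ⟨x, y, z, h⟩ := hΛ.exists_three
  refine degree_le_of_eq_PZ ⟨x, by simp⟩ h ?_
  calc ({x, y, z} : Set (Vertex O K 2)).encard ≤ ({y, z} : Set (Vertex O K 2)).encard + 1 :=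
        Set.encard_insert_le _ _
    _ ≤ 2 + 1 := by
      gcongr
      exact encard_pair_le y z

theorem isClosedOrder_and_degree_eq_zero_iff :
    IsClosedOrder Λ ∧ degree Λ = 0 ↔ IsMaximalOrder Λ := by
  constructor
  · rintro ⟨-, h⟩
    obtain ⟨𝓛, hΛ, hcard⟩ := exists_encard_of_degree_eq (n := 0) (by exact_mod_cast h)
    obtain ⟨x, rfl⟩ := Set.encard_eq_one.1 (by simpa using hcard)
    obtain ⟨g, hg⟩ := x.exists_endRing_eq
    refine isMaximalOrder_iff.2 ⟨g, ?_⟩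
    rw [hΛ, ← hg]
    ext X
    simp [mem_PZ]
  · intro h
    obtain ⟨g, hg⟩ := isMaximalOrder_iff.1 h
    have hΛ : Λ = PZ {(latticeOf O g).toVertex} := by
      ext X
      rw [mem_PZ, hg]
      simp only [Set.mem_singleton_iff, forall_eq]
      rfl
    refine ⟨⟨h.prop, eq_PZ_invariantClasses_of_eq_PZ hΛ⟩, le_antisymm ?_ zero_le⟩
    exact degree_le_of_eq_PZ (Set.singleton_nonempty _) hΛ (by simp)

/-- A maximal order is the degenerate case of a pair, with the two classes equal. -/
theorem IsMaximalOrder.isGraduatedOrder (hΛ : IsMaximalOrder Λ) : IsGraduatedOrder Λ := by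
  obtain ⟨g, hg⟩ := isMaximalOrder_iff.1 hΛ
  refine isGraduatedOrder_of_eq_PZ_pair hΛ.prop (x := (latticeOf O g).toVertex)
    (y := (latticeOf O g).toVertex) ?_
  ext X
  rw [mem_PZ, hg]
  simp only [Set.mem_insert_iff, Set.mem_singleton_iff, or_self, forall_eq]
  rfl

theorem isClosedOrder_and_degree_eq_one_iff :
    IsClosedOrder Λ ∧ degree Λ = 1 ↔ IsGraduatedOrder Λ ∧ ¬ IsMaximalOrder Λ := by
  constructor
  · rintro ⟨hcl, h⟩
    refine ⟨?_, fun hmax => ?_⟩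
    · obtain ⟨𝓛, hΛ, hcard⟩ := exists_encard_of_degree_eq (n := 1) (by exact_mod_cast h)
      obtain ⟨x, y, -, rfl⟩ := Set.encard_eq_two.1 (hcard.trans one_add_one_eq_two)
      exact isGraduatedOrder_of_eq_PZ_pair hcl.1 hΛ
    · rw [(isClosedOrder_and_degree_eq_zero_iff.2 hmax).2] at h
      exact zero_ne_one h
  · rintro ⟨hgr, hmax⟩
    obtain ⟨x, y, hΛ⟩ := hgr.exists_pair
    have hcl : IsClosedOrder Λ := ⟨hgr.1, eq_PZ_invariantClasses_of_eq_PZ hΛ⟩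
    refine ⟨hcl, le_antisymm ?_ ?_⟩
    · exact degree_le_of_eq_PZ ⟨x, by simp⟩ hΛ ((encard_pair_le x y).trans_eq
        one_add_one_eq_two.symm)
    · exact Order.one_le_iff_ne_zero.2 fun h0 =>
        hmax (isClosedOrder_and_degree_eq_zero_iff.1 ⟨hcl, h0⟩)

theorem IsClosedOrder.degree_eq (hΛ : IsClosedOrder Λ) :
    degree Λ = 0 ∨ degree Λ = 1 ∨ degree Λ = 2 := by
  have h := hΛ.degree_le_two
  lift degree Λ to ℕ using ne_top_of_le_ne_top (by decide) h with n
  norm_cast at h ⊢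
  omega

end

end BolytropeOrders

theorem mainTheorem10 (O : Type*) [CommRing O] [IsDomain O] [IsDiscreteValuationRing O]
    (K : Type*) [Field K] [Algebra O K] [IsFractionRing O K]
    (Λ : Subalgebra O (Matrix (Fin 2) (Fin 2) K)) :
    (BolytropeOrders.IsClosedOrder Λ →
      BolytropeOrders.degree Λ = 0 ∨ BolytropeOrders.degree Λ = 1 ∨
        BolytropeOrders.degree Λ = 2) ∧
    (BolytropeOrders.IsClosedOrder Λ ∧ BolytropeOrders.degree Λ = 0 ↔
      BolytropeOrders.IsMaximalOrder Λ) ∧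
    (BolytropeOrders.IsClosedOrder Λ ∧ BolytropeOrders.degree Λ = 1 ↔
      BolytropeOrders.IsGraduatedOrder Λ ∧ ¬ BolytropeOrders.IsMaximalOrder Λ) ∧
    (BolytropeOrders.IsClosedOrder Λ → ¬ BolytropeOrders.IsGraduatedOrder Λ →
      BolytropeOrders.degree Λ = 2) := by
  refine ⟨fun h => h.degree_eq, BolytropeOrders.isClosedOrder_and_degree_eq_zero_iff,
    BolytropeOrders.isClosedOrder_and_degree_eq_one_iff, fun h hgr => ?_⟩
  rcases h.degree_eq with h0 | h1 | h2
  · exact absurd (BolytropeOrders.isClosedOrder_and_degree_eq_zero_iff.1 ⟨h, h0⟩).isGraduatedOrder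
      hgr
  · exact absurd (BolytropeOrders.isClosedOrder_and_degree_eq_one_iff.1 ⟨h, h1⟩).1 hgr
  · exact h2
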